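/- Let $I=[0,\infty)$ or $I=(0,\infty)$. A probability distribution $\mu$ on $\mathbb R$ is called geometrically infinitely divisible (g.i.d.) if for every $p\in(0,1)$ it is the law of $\sum_{j=1}^{N_p}X^{(p)}_j$, where $N_p,X^{(p)}_1,X^{(p)}_2,\dots$ are independent real random variables, the $X^{(p)}_j$ are identically distributed and $P\{N_p=n\}=p(1-p)^{n-1}$, $n=1,2,\dots$. The following four classes of probability distributions on $I$ are identical. (i) The g.i.d. distributions on $I$, together with the distributions on $I$ that are weak limits of sequences of such distributions. (ii) The distributions on $I$ whose characteristic function $g$ satisfies, for all $t\in\mathbb R$, $$g(t)=\lim_{n\to\infty}\frac{1}{1+\sum_{k=1}^{k_n}\lambda_{n,k}\left(1-e^{i\beta_{n,k}t}\right)}$$ for some nonnegative integers $k_n$, reals $\lambda_{n,k}>0$ and $\beta_{n,k}\in\mathbb R$. (iii) The distributions on $I$ that are weak limits, as $n\to\infty$, of the laws of $\sum_{j=1}^{N_n}X_{n,j}$, where $N_n$ has the geometric distribution on $\{1,2,\dots\}$ with mean $n$ and is independent of $(X_{n,j})_j$; for each $n\ge 1$ the $X_{n,j}$, $j\ge1$,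 are independent with a common distribution on $I$ whose Laplace transform is $e^{-\psi(s)/n}$, $s\ge 0$, for a real function $\psi$ not depending on $n$; and the $X_{n,j}$ are uniformly asymptotically negligible, that is, $\sup_jP\{|X_{n,j}|>\varepsilon\}\to0$ for every $\varepsilon>0$. (iv) The inter-arrival time distributions $G$ on $I$ of Cox and renewal processes. Here the ordinary renewal process with inter-arrival time distribution $G$ is called a Cox process if for every $p\in(0,1)$ there is a distribution $F_p$ on $I$ such that it is the $p$-thinning of the renewal process with inter-arrival time distribution $F_p$; the $p$-thinning retains each epoch $t_1,t_2,\dots$ with probability $p$ and deletes it with probability $1-p$, independently of the other epochs and of the process. -/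

import Mathlib

open MeasureTheory ProbabilityTheory Filter Topology

namespace GeomInfDiv

/-- `P{N = k} = p (1 - p)^(k - 1)` for `k = 1, 2, …`; for `0 < p ≤ 1` this is the geometric
distribution with mean `1 / p`. -/
def IsGeometric {Ω : Type} [MeasurableSpace Ω] (P : Measure Ω) (p : ℝ) (N : Ω → ℕ) : Prop :=
  Measurable N ∧ ∀ k : ℕ, P {ω | N ω = k + 1} = ENNReal.ofReal (p * (1 - p) ^ k)

/-- `μ` is the law of `X₁ + ⋯ + X_N`, where `N, X₁, X₂, …` are independent, the `X_j` have the
common law `ν` and `N` is geometric on `{1, 2, …}` with parameter `p`.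
(`X_{j+1}` is called `X j`.) -/
def IsGeomSum (p : ℝ) (ν μ : ProbabilityMeasure ℝ) : Prop :=
  ∃ (Ω : Type) (_ : MeasurableSpace Ω) (P : Measure Ω) (X : ℕ → Ω → ℝ) (N : Ω → ℕ),
    IsProbabilityMeasure P ∧
    (∀ j, Measurable (X j)) ∧
    (∀ j, HasLaw (X j) (ν : Measure ℝ) P) ∧
    iIndepFun X P ∧
    IsGeometric P p N ∧
    IndepFun N (fun ω j => X j ω) P ∧
    HasLaw (fun ω => ∑ j ∈ Finset.range (N ω), X j ω) (μ : Measure ℝ) P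

/-- Geometric infinite divisibility. -/
def IsGID (μ : ProbabilityMeasure ℝ) : Prop :=
  ∀ p : ℝ, 0 < p → p < 1 → ∃ ν : ProbabilityMeasure ℝ, IsGeomSum p ν μ

/-- The distribution `μ` is carried by the set `I`. -/
def CarriedBy (I : Set ℝ) (μ : ProbabilityMeasure ℝ) : Prop :=
  ∀ᵐ x ∂(μ : Measure ℝ), x ∈ I

/-- The distributions on `I` that are geometrically infinitely divisible, or are weak limits of
geometrically infinitely divisible distributions on `I`. -/
def gidClass (I : Set ℝ) : Set (ProbabilityMeasure ℝ) :=
  {μ | CarriedBy I μ ∧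
    (IsGID μ ∨ ∃ η : ℕ → ProbabilityMeasure ℝ,
      (∀ n, CarriedBy I (η n) ∧ IsGID (η n)) ∧ Tendsto η atTop (𝓝 μ))}

/-- The distributions on `I` whose characteristic function is a pointwise limit of functions
`1 / (1 + ∑_k λ_{n,k} (1 - exp (i β_{n,k} t)))` with finite sums and `λ_{n,k} > 0`. -/
def charFunLimitClass (I : Set ℝ) : Set (ProbabilityMeasure ℝ) :=
  {μ | CarriedBy I μ ∧
    ∃ (k : ℕ → ℕ) (l β : (n : ℕ) → Fin (k n) → ℝ),
      (∀ n j, 0 < l n j) ∧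
      ∀ t : ℝ, Tendsto
        (fun n => 1 / (1 + ∑ j, (l n j : ℂ) * (1 - Complex.exp (Complex.I * β n j * t))))
        atTop (𝓝 (charFun (μ : Measure ℝ) t))}

/-- The limit distributions on `I` of `X_{n,1} + ⋯ + X_{n,N_n}`, where `N_n` is geometric with
mean `n`, the summands of the `n`-th row have the common law `ν n` on `I` with Laplace transform
`exp (-ψ / n)`, and the summands are uniformly asymptotically negligible (in each row all the
summands have the same law, so the maximum over the row is attained by each of them). -/
def geomLimitClass (I : Set ℝ) : Set (ProbabilityMeasure ℝ) :=
  {μ | CarriedBy I μ ∧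
    ∃ (ψ : ℝ → ℝ) (ν η : ℕ → ProbabilityMeasure ℝ),
      (∀ n : ℕ, 1 ≤ n → CarriedBy I (ν n)) ∧
      (∀ n : ℕ, 1 ≤ n → ∀ s : ℝ, 0 ≤ s →
        ∫ x, Real.exp (-(s * x)) ∂(ν n : Measure ℝ) = Real.exp (-((1 / (n : ℝ)) * ψ s))) ∧
      (∀ ε : ℝ, 0 < ε →
        Tendsto (fun n => (ν n : Measure ℝ) {x | ε < |x|}) atTop (𝓝 0)) ∧
      (∀ n : ℕ, 1 ≤ n → IsGeomSum (1 / (n : ℝ)) (ν n) (η n)) ∧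
      Tendsto η atTop (𝓝 μ)}

/-- `0 = T 0, T 1, T 2, …` are the epochs of an ordinary renewal process with inter-arrival time
distribution `F`. -/
def IsRenewal {Ω : Type} [MeasurableSpace Ω] (P : Measure Ω) (F : ProbabilityMeasure ℝ)
    (T : ℕ → Ω → ℝ) : Prop :=
  (∀ ω, T 0 ω = 0) ∧
  (∀ n, HasLaw (fun ω => T (n + 1) ω - T n ω) (F : Measure ℝ) P) ∧
  iIndepFun (fun n ω => T (n + 1) ω - T n ω) P

/-- The epochs that remain when `T (n + 1)` is retained if `B n = true` and deleted otherwise;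
`T 0 = 0` is kept as the time origin.
(The value is arbitrary where only finitely many epochs are retained.) -/
noncomputable def retained {Ω : Type} (T : ℕ → Ω → ℝ) (B : ℕ → Ω → Bool) : ℕ → Ω → ℝ
  | 0, ω => T 0 ω
  | k + 1, ω => T (Nat.nth (fun n => B n ω = true) k + 1) ω

/-- The renewal process with inter-arrival time distribution `G` is the `p`-thinning of the renewal
process with inter-arrival time distribution `F`: every epoch is retained with probability `p`,
independently of the other epochs and of the process. -/
def IsThinning (p : ℝ) (F G : ProbabilityMeasure ℝ) : Prop :=
  ∃ (Ω : Type) (_ : MeasurableSpace Ω) (P : Measure Ω) (T : ℕ → Ω → ℝ) (B : ℕ → Ω → Bool),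
    IsProbabilityMeasure P ∧
    (∀ n, Measurable (T n)) ∧
    IsRenewal P F T ∧
    (∀ n, Measurable (B n)) ∧
    (∀ n, P {ω | B n ω = true} = ENNReal.ofReal p) ∧
    iIndepFun B P ∧
    IndepFun (fun ω n => B n ω) (fun ω n => T n ω) P ∧
    IsRenewal P G (retained T B)

/-- The inter-arrival time distributions on `I` of Cox and renewal processes: for every
`p ∈ (0, 1)` the renewal process is the `p`-thinning of a renewal process. -/
def coxRenewalClass (I : Set ℝ) : Set (ProbabilityMeasure ℝ) :=
  {G | CarriedBy I G ∧
    ∀ p : ℝ, 0 < p → p < 1 →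
      ∃ F : ProbabilityMeasure ℝ, CarriedBy I F ∧ IsThinning p F G}

end GeomInfDiv

/-!
A law with characteristic function `g` is a geometric sum with parameter `p` of a law with
characteristic function `f` exactly when `f⁻¹ = 1 + p θ`, where `θ = g⁻¹ - 1`. So `g` is
geometrically infinitely divisible precisely when every `1 / (1 + p θ)` is a characteristic
function, a condition that survives pointwise limits and holds for `θ = c (1 - f)`; conversely,
`θ` is the limit of such exponents. Approximating `f` by laws with finite support gives the
compound Poisson exponents of the second class. The powers `(1 + θ / m) ^ (-m)` converge to
`exp (-θ)`, which produces the summands of the third class. Finally, the first retained epoch of a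
thinned renewal process is a geometric sum of the gaps, and the process regenerates there.
-/

namespace GeomInfDiv

/-! ### Transforms of geometric sums -/

section RandomSums

variable {Ω : Type*} [MeasurableSpace Ω] {P : Measure Ω} {X : ℕ → Ω → ℝ} {N : Ω → ℕ}
  {ν : Measure ℝ} {z : ℂ}

lemma norm_complexMGF_le_one [IsProbabilityMeasure ν] (hz : ∀ᵐ x ∂ν, z.re * x ≤ 0) :
    ‖complexMGF id ν z‖ ≤ 1 := by
  have hexp : ∀ᵐ x : ℝ ∂ν, ‖Complex.exp (z * (id x : ℝ))‖ ≤ 1 := by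
    filter_upwards [hz] with x hx
    simpa [Complex.norm_exp] using hx
  simpa [complexMGF] using norm_integral_le_of_norm_le_const hexp

lemma complexMGF_sum_range (hX : ∀ j, HasLaw (X j) ν P) (hindep : iIndepFun X P) (n : ℕ) :
    complexMGF (fun ω => ∑ j ∈ Finset.range n, X j ω) P z = complexMGF id ν z ^ n := by
  have hprod := (hindep.precomp (Fin.val_injective (n := n))).integral_fun_prod_comp
    (f := fun _ x => Complex.exp (z * (x : ℝ))) (fun j => (hX j).aemeasurable)
    (fun j => by fun_prop)
  have hterm (j : ℕ) : ∫ ω, Complex.exp (z * (X j ω : ℝ)) ∂P = complexMGF id ν z := by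
    rw [← (hX j).map_eq, complexMGF_id_map (hX j).aemeasurable, complexMGF]
  simp only [hterm, Finset.prod_const, Finset.card_univ, Fintype.card_fin] at hprod
  rw [complexMGF, ← hprod]
  congr with ω
  rw [← Complex.exp_sum, Fin.sum_univ_eq_sum_range (fun j => z * (X j ω : ℂ)), ← Finset.mul_sum,
    Complex.ofReal_sum]

lemma measurable_sum_range : Measurable fun q : ℕ × (ℕ → ℝ) => ∑ j ∈ Finset.range q.1, q.2 j :=
  measurable_from_prod_countable_right fun n => by dsimp only; fun_prop

theorem complexMGF_randomSum (hX : ∀ j, HasLaw (X j) ν P) (hindep : iIndepFun X P)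
    (hN : Measurable N) (hNX : IndepFun N (fun ω j => X j ω) P) (hz : ∀ᵐ x ∂ν, z.re * x ≤ 0) :
    complexMGF (fun ω => ∑ j ∈ Finset.range (N ω), X j ω) P z
      = ∫ ω, complexMGF id ν z ^ N ω ∂P := by
  have := hindep.isProbabilityMeasure
  have hY : AEMeasurable (fun ω j => X j ω) P :=
    aemeasurable_pi_lambda _ fun j => (hX j).aemeasurable
  have hlaw : HasLaw (fun ω => (N ω, fun j => X j ω))
      ((P.map N).prod (P.map fun ω j => X j ω)) P :=
    IndepFun.hasLaw_prod ⟨hN.aemeasurable, rfl⟩ ⟨hY, rfl⟩ hNX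
  let e : ℕ × (ℕ → ℝ) → ℂ := fun q => Complex.exp (z * ↑(∑ j ∈ Finset.range q.1, q.2 j))
  have he : Measurable e := by
    have := measurable_sum_range
    fun_prop
  have hbound : ∀ᵐ ω ∂P, ‖e (N ω, fun j => X j ω)‖ ≤ 1 := by
    have hset : Measurable fun x => z.re * x ≤ 0 :=
      measurableSet_setOfPred.1 (measurableSet_le (by fun_prop) (by fun_prop))
    have hXz : ∀ᵐ ω ∂P, ∀ j, z.re * X j ω ≤ 0 :=
      ae_all_iff.2 fun j => ((hX j).ae_iff hset).2 hz
    filter_upwards [hXz] with ω hω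
    simpa [e, Complex.norm_exp, Finset.mul_sum] using Finset.sum_nonpos fun j _ => hω j
  have hint : Integrable e ((P.map N).prod (P.map fun ω j => X j ω)) := by
    rw [← hlaw.map_eq, integrable_map_measure he.aestronglyMeasurable hlaw.aemeasurable]
    exact .of_bound (he.comp_aemeasurable hlaw.aemeasurable).aestronglyMeasurable 1 hbound
  calc complexMGF (fun ω => ∑ j ∈ Finset.range (N ω), X j ω) P z
      = ∫ q, e q ∂(P.map N).prod (P.map fun ω j => X j ω) :=
        hlaw.integral_comp he.aestronglyMeasurable
    _ = ∫ n, ∫ y, e (n, y) ∂(P.map fun ω j => X j ω) ∂(P.map N) := integral_prod e hint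
    _ = ∫ n, complexMGF id ν z ^ n ∂(P.map N) := by
        congr with n
        rw [← complexMGF_sum_range hX hindep n]
        exact integral_map hY (he.comp measurable_prodMk_left).aestronglyMeasurable
    _ = ∫ ω, complexMGF id ν z ^ N ω ∂P := integral_map hN.aemeasurable (by fun_prop)

end RandomSums

section GeometricSums

lemma IsGeometric.le_one {Ω : Type} [MeasurableSpace Ω] {P : Measure Ω} [IsProbabilityMeasure P]
    {p : ℝ} {N : Ω → ℕ} (hN : IsGeometric P p N) : p ≤ 1 := by
  have h := hN.2 0
  rw [pow_zero, mul_one] at h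
  exact ENNReal.ofReal_le_one.1 (h ▸ prob_le_one)

lemma ext_of_singleton_succ {κ κ' : Measure ℕ} [IsProbabilityMeasure κ] [IsProbabilityMeasure κ']
    (h : ∀ k, κ {k + 1} = κ' {k + 1}) : κ = κ' := by
  have hcompl : κ {0}ᶜ = κ' {0}ᶜ := by
    have hunion : ({0}ᶜ : Set ℕ) = ⋃ k : ℕ, {k + 1} := by
      ext (_ | k) <;> simp
    have hdisj : Pairwise (Function.onFun Disjoint fun k : ℕ => ({k + 1} : Set ℕ)) :=
      fun i j hij => by simpa using hij
    rw [hunion, measure_iUnion hdisj fun _ => .singleton _,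
      measure_iUnion hdisj fun _ => .singleton _]
    exact tsum_congr h
  refine Measure.ext_of_singleton fun k => ?_
  cases k with
  | zero =>
    rw [← compl_compl ({0} : Set ℕ), prob_compl_eq_one_sub .of_discrete, hcompl,
      ← prob_compl_eq_one_sub .of_discrete]
  | succ k => exact h k

lemma IsGeometric.hasLaw {Ω : Type} [MeasurableSpace Ω] {P : Measure Ω} [IsProbabilityMeasure P]
    {p : unitInterval} (hp : p ≠ 0) {N : Ω → ℕ} (hN : IsGeometric P p N) :
    HasLaw N ((geometricMeasure p).map (· + 1)) P where
  aemeasurable := hN.1.aemeasurable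
  map_eq := by
    have := Measure.isProbabilityMeasure_map (μ := P) hN.1.aemeasurable
    have := Measure.isProbabilityMeasure_map (μ := geometricMeasure p)
      (f := (· + 1)) (by fun_prop)
    refine ext_of_singleton_succ fun k => ?_
    rw [Measure.map_apply hN.1 (.singleton _), Measure.map_apply (by fun_prop) (.singleton _)]
    have hpre : (· + 1) ⁻¹' {k + 1} = ({k} : Set ℕ) := by ext; simp
    rw [hpre, geometricMeasure_singleton hp, mul_comm]
    exact hN.2 k

lemma IsGeometric.integral_pow_mul {Ω : Type} [MeasurableSpace Ω] {P : Measure Ω}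
    [IsProbabilityMeasure P] {p : ℝ} (hp : 0 < p) {N : Ω → ℕ} (hN : IsGeometric P p N) {a : ℂ}
    (ha : ‖a‖ ≤ 1) : (∫ ω, a ^ N ω ∂P) * (1 - (1 - p) * a) = p * a := by
  lift p to unitInterval using ⟨hp.le, hN.le_one⟩
  have hratio : ‖(1 - (p : ℂ)) * a‖ < 1 := by
    rw [norm_mul, ← Complex.ofReal_one, ← Complex.ofReal_sub, Complex.norm_real,
      Real.norm_of_nonneg (sub_nonneg.2 p.2.2)]
    nlinarith [norm_nonneg a, p.2.2]
  have hne : 1 - (1 - (p : ℂ)) * a ≠ 0 := fun h => by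
    rw [← sub_eq_zero.1 h, norm_one] at hratio
    exact hratio.false
  have hgeom : ∫ ω, a ^ N ω ∂P = (p * a) * (1 - (1 - (p : ℂ)) * a)⁻¹ := by
    rw [← tsum_geometric_of_norm_lt_one hratio, ← tsum_mul_left]
    have := (hN.hasLaw (Subtype.coe_ne_coe.1 hp.ne')).integral_comp (f := (a ^ ·)) (by fun_prop)
    rw [Function.comp_def] at this
    rw [this, integral_map (by fun_prop) (by fun_prop), integral_geometricMeasure
      (Subtype.coe_ne_coe.1 hp.ne')]
    refine tsum_congr fun k => ?_
    rw [Complex.real_smul, mul_pow, pow_succ]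
    push_cast
    ring
  rw [hgeom, inv_mul_cancel_right₀ hne]

lemma IsGeomSum.le_one {p : ℝ} {ν μ : ProbabilityMeasure ℝ} (h : IsGeomSum p ν μ) : p ≤ 1 := by
  obtain ⟨Ω, _, P, X, N, hP, -, -, -, hN, -⟩ := h
  exact hN.le_one

theorem IsGeomSum.complexMGF_mul {p : ℝ} (hp : 0 < p) {ν μ : ProbabilityMeasure ℝ}
    (h : IsGeomSum p ν μ) {z : ℂ} (hz : ∀ᵐ x : ℝ ∂(ν : Measure ℝ), z.re * x ≤ 0) :
    complexMGF id μ z * (1 - (1 - p) * complexMGF id ν z) = p * complexMGF id ν z := by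
  obtain ⟨Ω, _, P, X, N, hP, -, hX, hindep, hN, hNX, hS⟩ := h
  rw [← hS.map_eq, complexMGF_id_map hS.aemeasurable,
    complexMGF_randomSum hX hindep hN.1 hNX hz, hN.integral_pow_mul hp (norm_complexMGF_le_one hz)]

lemma IsGeomSum.charFun_mul {p : ℝ} (hp : 0 < p) {ν μ : ProbabilityMeasure ℝ}
    (h : IsGeomSum p ν μ) (t : ℝ) :
    charFun (μ : Measure ℝ) t * (1 - (1 - p) * charFun (ν : Measure ℝ) t)
      = p * charFun (ν : Measure ℝ) t := by
  simp only [← complexMGF_id_mul_I]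
  exact h.complexMGF_mul hp (.of_forall fun x => by simp)

lemma IsGeomSum.carriedBy {p : ℝ} (hp : 0 < p) {ν μ : ProbabilityMeasure ℝ}
    (h : IsGeomSum p ν μ) {I : Set ℝ} (hI : MeasurableSet I) (hμ : CarriedBy I μ) :
    CarriedBy I ν := by
  obtain ⟨Ω, _, P, X, N, _, _, hX, -, hN, hNX, hS⟩ := h
  have hnull : P {ω | N ω = 1} * P {ω | X 0 ω ∈ Iᶜ} = 0 := by
    have hsum : ∀ᵐ ω ∂P, ∑ j ∈ Finset.range (N ω), X j ω ∈ I :=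
      (hS.ae_iff (measurableSet_setOfPred.1 hI)).2 hμ
    refine (hNX.measure_inter_preimage_eq_mul {1} {y | y 0 ∈ Iᶜ} (.singleton _)
      (measurable_pi_apply 0 hI.compl)).symm.trans (measure_mono_null ?_ hsum)
    rintro ω ⟨hω1 : N ω = 1, hω2 : X 0 ω ∉ I⟩ (hω3 : ∑ j ∈ Finset.range (N ω), X j ω ∈ I)
    rw [hω1, Finset.sum_range_one] at hω3
    exact hω2 hω3
  have hpos : P {ω | N ω = 1} ≠ 0 := by
    rw [hN.2 0]
    simpa using hp
  exact ((hX 0).ae_iff (measurableSet_setOfPred.1 hI)).1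
    ((mul_eq_zero.1 hnull).resolve_left hpos)

end GeometricSums

/-! ### The first retained epoch -/

section Nth

lemma nth_eq_true_zero_eq_iff {b : ℕ → Bool} (hb : ∃ n, b n = true) (m : ℕ) :
    Nat.nth (fun n => b n = true) 0 = m ↔ ∀ i ∈ Finset.range (m + 1), b i = decide (i = m) := by
  classical
  rw [Nat.nth_zero_of_exists hb, Nat.find_eq_iff, Finset.range_add_one, Finset.forall_mem_insert]
  refine and_congr (by simp) (forall_congr' fun i => ?_)
  rw [Finset.mem_range]
  refine forall_congr' fun hi => ?_
  simp [hi.ne]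

lemma frequently_atTop_add_iff {q : ℕ → Prop} (m : ℕ) :
    (∃ᶠ n in atTop, q (n + m)) ↔ ∃ᶠ n in atTop, q n := by
  rw [← frequently_map (m := (· + m)), map_add_atTop_eq_nat]

lemma nth_succ_eq_nth_add {q : ℕ → Prop} (hq : ∃ᶠ n in atTop, q n) (k : ℕ) :
    Nat.nth q (k + 1)
      = Nat.nth (fun n => q (n + (Nat.nth q 0 + 1))) k + (Nat.nth q 0 + 1) := by
  classical
  set m := Nat.nth q 0 + 1 with hm
  have hinf := Nat.frequently_atTop_iff_infinite.1 ((frequently_atTop_add_iff m).2 hq)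
  have hmem : q (Nat.nth (fun n => q (n + m)) k + m) := Nat.nth_mem_of_infinite hinf k
  have hcount : Nat.count q (Nat.nth (fun n => q (n + m)) k + m) = k + 1 := by
    rw [Nat.count_add', Nat.count_nth_of_infinite hinf, hm,
      Nat.count_nth_succ_of_infinite (Nat.frequently_atTop_iff_infinite.1 hq), zero_add]
  rw [← Nat.nth_count hmem, hcount]

lemma measurable_nth_zero :
    Measurable fun b : ℕ → Bool => Nat.nth (fun n => b n = true) 0 := by
  classical
  have hex (b : ℕ → Bool) : ∃ n, b n = true ∨ ¬ ∃ k, b k = true := by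
    by_cases hb : ∃ k, b k = true
    · exact hb.imp fun _ => Or.inl
    · exact ⟨0, Or.inr hb⟩
  have hfind : (fun b : ℕ → Bool => Nat.nth (fun n => b n = true) 0)
      = fun b => Nat.find (hex b) := by
    ext b
    by_cases hb : ∃ k, b k = true
    · simp only [hb, Nat.nth_zero_of_exists hb, not_true_eq_false, or_false]
    · have hfalse (n : ℕ) : ¬ b n = true := fun hn => hb ⟨n, hn⟩
      rw [(Nat.find_eq_zero (hex b)).2 (Or.inr hb), Nat.nth_zero]
      simp [hfalse]
  rw [hfind]
  refine measurable_find hex fun n => ?_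
  measurability

end Nth

section Bernoulli

variable {Ω : Type*} [MeasurableSpace Ω] {P : Measure Ω} {B : ℕ → Ω → Bool}

lemma ae_frequently_eq_true (hB : ∀ n, Measurable (B n)) (hindep : iIndepFun B P) {c : ENNReal}
    (hc : c ≠ 0) (hBc : ∀ n, P {ω | B n ω = true} = c) :
    ∀ᵐ ω ∂P, ∃ᶠ n in atTop, B n ω = true := by
  have := hindep.isProbabilityMeasure
  have hmeas (n : ℕ) : MeasurableSet {ω | B n ω = true} := hB n (measurableSet_singleton true)
  have hset : iIndepSet (fun n => {ω | B n ω = true}) P :=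
    (iIndepSet_iff_meas_biInter hmeas).2 fun s =>
      hindep.measure_inter_preimage_eq_mul s fun _ _ => measurableSet_singleton true
  have hlimsup := measure_limsup_eq_one hmeas hset
    (by simp only [hBc, ENNReal.tsum_const_eq_top_of_ne_zero hc])
  filter_upwards [(mem_ae_iff_prob_eq_one (.measurableSet_limsup hmeas)).2 hlimsup] with ω hω
  exact (mem_limsup_iff_frequently_mem (s := fun n => {ω | B n ω = true})).1 hω

lemma measure_nth_zero_eq [IsProbabilityMeasure P] (hB : ∀ n, Measurable (B n))
    (hindep : iIndepFun B P) {p : ℝ} (hp : 0 < p)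
    (hBp : ∀ n, P {ω | B n ω = true} = ENNReal.ofReal p) (m : ℕ) :
    P {ω | Nat.nth (fun n => B n ω = true) 0 = m} = ENNReal.ofReal (p * (1 - p) ^ m) := by
  have hfirst : {ω | Nat.nth (fun n => B n ω = true) 0 = m}
      =ᵐ[P] (⋂ i ∈ Finset.range (m + 1), B i ⁻¹' {decide (i = m)} : Set Ω) := by
    filter_upwards [ae_frequently_eq_true hB hindep (ENNReal.ofReal_pos.2 hp).ne' hBp] with ω hω
    refine propext ?_
    change Nat.nth (fun n => B n ω = true) 0 = m ↔ ω ∈ ⋂ i ∈ Finset.range (m + 1), B i ⁻¹' _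
    rw [nth_eq_true_zero_eq_iff hω.exists]
    simp only [Set.mem_iInter, Set.mem_preimage, Set.mem_singleton_iff]
  have hfalse (i : ℕ) : P (B i ⁻¹' {false}) = ENNReal.ofReal (1 - p) := by
    rw [← Bool.not_true, ← Bool.compl_singleton, Set.preimage_compl,
      prob_compl_eq_one_sub (hB i (.singleton true)), ENNReal.ofReal_sub _ hp.le,
      ENNReal.ofReal_one]
    exact congrArg _ (hBp i)
  have hp1 : p ≤ 1 := ENNReal.ofReal_le_one.1 (hBp 0 ▸ prob_le_one)
  calc P {ω | Nat.nth (fun n => B n ω = true) 0 = m}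
      = ∏ i ∈ Finset.range (m + 1), P (B i ⁻¹' {decide (i = m)}) := by
        rw [measure_congr hfirst, hindep.measure_inter_preimage_eq_mul _ fun _ _ => .singleton _]
    _ = (∏ i ∈ Finset.range m, P (B i ⁻¹' {false})) * P {ω | B m ω = true} := by
        rw [Finset.prod_range_succ, decide_eq_true rfl]
        refine congrArg (· * _) (Finset.prod_congr rfl fun i hi => ?_)
        rw [decide_eq_false (Finset.mem_range.1 hi).ne]
    _ = ENNReal.ofReal (p * (1 - p) ^ m) := by
        simp only [hfalse, hBp, Finset.prod_const, Finset.card_range]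
        rw [mul_comm, ENNReal.ofReal_mul hp.le, ENNReal.ofReal_pow (sub_nonneg.2 hp1)]

end Bernoulli

theorem IsThinning.isGeomSum {p : ℝ} (hp : 0 < p) {F G : ProbabilityMeasure ℝ}
    (h : IsThinning p F G) : IsGeomSum p F G := by
  obtain ⟨Ω, _, P, T, B, hP, hT, ⟨-, hgap, hindep⟩, hB, hBp, hBindep, hBT, -, hG, -⟩ := h
  have hN := measurable_nth_zero.add_const 1
  refine ⟨Ω, _, P, fun j ω => T (j + 1) ω - T j ω,
    fun ω => Nat.nth (fun n => B n ω = true) 0 + 1, hP, fun j => (hT _).sub (hT _), hgap, hindep,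
    ⟨hN.comp (measurable_pi_lambda _ hB), fun k => ?_⟩, ?_, ?_⟩
  · simpa only [add_left_inj] using measure_nth_zero_eq hB hBindep hp hBp k
  · exact hBT.comp (ψ := fun t j => t (j + 1) - t j) hN (by fun_prop)
  · exact (hG 0).congr (.of_forall fun ω => Finset.sum_range_sub (fun j => T j ω) _)

section Regeneration

variable {Ω Ω' β : Type*} [MeasurableSpace Ω] [MeasurableSpace Ω'] [MeasurableSpace β]
  {P : Measure Ω} {Q : Measure Ω'}

lemma measure_inter_randomIndex {τ : Ω → ℕ} (hτ : Measurable τ) {Y : ℕ → Ω → β}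
    {S : ℕ → Ω → Ω'} (hS : ∀ m, MeasurePreserving (S m) P Q)
    (hindep : ∀ m, IndepFun (fun ω => (τ ω = m, Y m ω)) (S m) P) {A : Set β} {C : Set Ω'}
    (hA : MeasurableSet A) (hC : MeasurableSet C) :
    P {ω | Y (τ ω) ω ∈ A ∧ S (τ ω) ω ∈ C} = P {ω | Y (τ ω) ω ∈ A} * Q C := by
  have hsplit (s : Set Ω) : P s = ∑' m, P (s ∩ τ ⁻¹' {m}) := by
    have hfiber := tsum_measure_preimage_singleton (μ := P.restrict s) Set.countable_univ
      fun m _ => hτ (.singleton m)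
    rw [tsum_univ fun m => P.restrict s (τ ⁻¹' {m}), Set.preimage_univ,
      Measure.restrict_apply_univ] at hfiber
    rw [← hfiber]
    exact tsum_congr fun m => by rw [Measure.restrict_apply (hτ (.singleton m)), Set.inter_comm]
  rw [hsplit {ω | Y (τ ω) ω ∈ A ∧ S (τ ω) ω ∈ C}, hsplit {ω | Y (τ ω) ω ∈ A},
    ← ENNReal.tsum_mul_right]
  refine tsum_congr fun m => ?_
  have hm := (hindep m).measure_inter_preimage_eq_mul ({True} ×ˢ A) C
    ((MeasurableSet.singleton True).prod hA) hC
  rw [(hS m).measure_preimage hC.nullMeasurableSet] at hm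
  convert! hm using 2
  · ext ω
    grind
  · congr 1
    ext ω
    grind

lemma measurable_randomIndex {τ : Ω → ℕ} (hτ : Measurable τ) {Y : ℕ → Ω → β}
    (hY : ∀ m, Measurable (Y m)) : Measurable fun ω => Y (τ ω) ω :=
  (measurable_from_prod_countable_right (f := fun q : ℕ × Ω => Y q.1 q.2) hY).comp
    (hτ.prodMk measurable_id)

lemma measurePreserving_randomIndex [IsProbabilityMeasure P] {τ : Ω → ℕ} (hτ : Measurable τ)
    {S : ℕ → Ω → Ω'} (hS : ∀ m, MeasurePreserving (S m) P Q)
    (hindep : ∀ m, IndepFun (fun ω => τ ω = m) (S m) P) :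
    MeasurePreserving (fun ω => S (τ ω) ω) P Q := by
  have hmeas := measurable_randomIndex hτ fun m => (hS m).measurable
  refine ⟨hmeas, Measure.ext fun C hC => ?_⟩
  have h := measure_inter_randomIndex (Y := fun _ _ => ()) hτ hS (fun m =>
    (hindep m).comp (φ := fun q => (q, ())) (by fun_prop) measurable_id) .univ hC
  rw [Measure.map_apply hmeas hC]
  simpa using! h

lemma indepFun_randomIndex [IsProbabilityMeasure P] {τ : Ω → ℕ} (hτ : Measurable τ)
    {Y : ℕ → Ω → β} {S : ℕ → Ω → Ω'} (hS : ∀ m, MeasurePreserving (S m) P Q)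
    (hindep : ∀ m, IndepFun (fun ω => (τ ω = m, Y m ω)) (S m) P) :
    IndepFun (fun ω => Y (τ ω) ω) (fun ω => S (τ ω) ω) P := by
  have hpres := measurePreserving_randomIndex hτ hS fun m =>
    (hindep m).comp measurable_fst measurable_id
  refine indepFun_iff_measure_inter_preimage_eq_mul.2 fun A C hA hC => ?_
  rw [hpres.measure_preimage hC.nullMeasurableSet]
  exact measure_inter_randomIndex hτ hS hindep hA hC

lemma measure_biInter_range_iterate [IsProbabilityMeasure P] {D : Ω → β} {S : Ω → Ω}
    (hD : Measurable D) (hS : MeasurePreserving S P P) (hDS : IndepFun D S P) (n : ℕ)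
    {A : ℕ → Set β} (hA : ∀ i, MeasurableSet (A i)) :
    P (⋂ i ∈ Finset.range n, (D ∘ S^[i]) ⁻¹' A i) = ∏ i ∈ Finset.range n, P (D ⁻¹' A i) := by
  induction n generalizing A with
  | zero => simp
  | succ n ih =>
    have hsplit : (⋂ i ∈ Finset.range (n + 1), (D ∘ S^[i]) ⁻¹' A i)
        = D ⁻¹' A 0 ∩ S ⁻¹' (⋂ i ∈ Finset.range n, (D ∘ S^[i]) ⁻¹' A (i + 1)) := by
      simp only [Finset.mem_range]
      rw [Set.biInter_lt_succ']
      simp only [Set.preimage_iInter, Function.iterate_succ]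
      rfl
    have hmeas : MeasurableSet (⋂ i ∈ Finset.range n, (D ∘ S^[i]) ⁻¹' A (i + 1)) :=
      Finset.measurableSet_biInter _ fun i _ => (hD.comp (hS.measurable.iterate i)) (hA (i + 1))
    rw [hsplit, hDS.measure_inter_preimage_eq_mul _ _ (hA 0) hmeas,
      hS.measure_preimage hmeas.nullMeasurableSet, ih fun i => hA (i + 1),
      Finset.prod_range_succ', mul_comm]

lemma iIndepFun_of_range {X : ℕ → Ω → β}
    (hX : ∀ (n : ℕ) (A : ℕ → Set β), (∀ i, MeasurableSet (A i)) →
      P (⋂ i ∈ Finset.range n, X i ⁻¹' A i) = ∏ i ∈ Finset.range n, P (X i ⁻¹' A i)) :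
    iIndepFun X P := by
  classical
  have : IsProbabilityMeasure P := ⟨by simpa using hX 0 (fun _ => .univ) fun _ => .univ⟩
  refine iIndepFun_iff_measure_inter_preimage_eq_mul.2 fun s A hA => ?_
  obtain ⟨n, hn⟩ := s.exists_nat_subset_range
  have h := hX n (fun i => if i ∈ s then A i else .univ) fun i => by
    split_ifs with hi
    exacts [hA i hi, .univ]
  have hinter : (⋂ i ∈ Finset.range n, X i ⁻¹' if i ∈ s then A i else .univ)
      = ⋂ i ∈ s, X i ⁻¹' A i := by
    ext ω
    simp only [Set.mem_iInter, Set.mem_preimage, Set.mem_ite_univ_right]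
    exact ⟨fun h i hi => h i (hn hi) hi, fun h i _ hi => h i hi⟩
  rw [hinter, ← Finset.prod_subset hn fun i _ hi => by simp [hi]] at h
  exact h.trans (Finset.prod_congr rfl fun i hi => by rw [if_pos hi])

theorem iIndepFun_comp_iterate [IsProbabilityMeasure P] {D : Ω → β} {S : Ω → Ω}
    (hD : Measurable D) (hS : MeasurePreserving S P P) (hDS : IndepFun D S P) :
    iIndepFun (fun k => D ∘ S^[k]) P :=
  iIndepFun_of_range fun n A hA => by
    rw [measure_biInter_range_iterate hD hS hDS n hA]
    refine Finset.prod_congr rfl fun i _ => ?_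
    rw [Set.preimage_comp, (hS.iterate i).measure_preimage (hD (hA i)).nullMeasurableSet]

end Regeneration

/-! ### Thinned renewal processes -/

section SequenceSpace

variable {E E' : Type*} [MeasurableSpace E] [MeasurableSpace E']

lemma measurePreserving_add_right_infinitePi (κ : Measure E) [IsProbabilityMeasure κ] (m : ℕ) :
    MeasurePreserving (fun (ω : ℕ → E) n => ω (n + m)) (Measure.infinitePi fun _ => κ)
      (Measure.infinitePi fun _ => κ) where
  measurable := by fun_prop
  map_eq := Measure.map_infinitePi_infinitePi_of_inj (add_left_injective m)

lemma indepFun_range_add_right_infinitePi (κ : ℕ → Measure E) [∀ n, IsProbabilityMeasure (κ n)]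
    (m : ℕ) :
    IndepFun (fun ω (i : Finset.range m) => ω i) (fun (ω : ℕ → E) n => ω (n + m))
      (Measure.infinitePi κ) := by
  classical
  refine IndepFun.indepFun_process (by fun_prop) (by fun_prop) fun J => ?_
  have hdisj : Disjoint (Finset.range m) (J.map (addRightEmbedding m)) := by
    rw [Finset.disjoint_left]
    grind
  have hcoord : iIndepFun (fun n (ω : ℕ → E) => ω n) (Measure.infinitePi κ) :=
    iIndepFun_infinitePi (X := fun _ x => x) fun _ => measurable_id
  exact (hcoord.indepFun_finset _ _ hdisj (by fun_prop)).comp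
    (ψ := fun x (j : J) => x ⟨j + m, Finset.mem_map_of_mem _ j.2⟩) measurable_id (by fun_prop)

lemma indepFun_fst_snd_infinitePi {ι : Type*} (κ : ι → Measure E) (κ' : ι → Measure E')
    [∀ i, IsProbabilityMeasure (κ i)] [∀ i, IsProbabilityMeasure (κ' i)] :
    IndepFun (fun (ω : ι → E × E') i => (ω i).1) (fun ω i => (ω i).2)
      (Measure.infinitePi fun i => (κ i).prod (κ' i)) := by
  classical
  refine IndepFun.process_indepFun_process (by fun_prop) (by fun_prop) fun I J => ?_
  have hprod := measurePreserving_arrowProdEquivProdArrow E E' ↥(I ∪ J) (fun i => κ i)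
    (fun i => κ' i)
  have hrestrict : MeasurePreserving (I ∪ J).restrict
      (Measure.infinitePi fun i => (κ i).prod (κ' i))
      (Measure.pi fun i : ↥(I ∪ J) => (κ i).prod (κ' i)) :=
    ⟨by fun_prop, Measure.infinitePi_map_restrict _⟩
  have hpres := hprod.comp hrestrict
  have hindep := (indepFun_iff_hasLaw_prodMk_prod (measurePreserving_fst.comp hpres).hasLaw
    (measurePreserving_snd.comp hpres).hasLaw).2 hpres.hasLaw
  exact hindep.comp (φ := fun x (i : I) => x ⟨i, Finset.mem_union_left _ i.2⟩)
    (ψ := fun x (j : J) => x ⟨j, Finset.mem_union_right _ j.2⟩) (by fun_prop) (by fun_prop)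

end SequenceSpace

/-- Realisations of a marked renewal process: `(ω n).1` is the gap before the epoch `n + 1`, and
this epoch is retained if `(ω n).2 = true`. -/
abbrev MarkedGaps : Type := ℕ → ℝ × Bool

namespace MarkedGaps

/-- The epochs of a marked renewal process, where the epoch `0` is the time origin. -/
def epoch (n : ℕ) (ω : MarkedGaps) : ℝ := ∑ j ∈ Finset.range n, (ω j).1

/-- The marks; as in `retained`, the mark with index `n` belongs to the epoch `n + 1`. -/
def mark (n : ℕ) (ω : MarkedGaps) : Bool := (ω n).2

/-- The index of the first marked epoch, counted from `0`. It is `0` if there is none. -/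
noncomputable def firstMark (ω : MarkedGaps) : ℕ := Nat.nth (fun n => mark n ω = true) 0

/-- The first retained epoch. -/
noncomputable def firstRetained (ω : MarkedGaps) : ℝ := epoch (firstMark ω + 1) ω

/-- The marked renewal process that starts anew at the first retained epoch. -/
noncomputable def afterMark (ω : MarkedGaps) : MarkedGaps := fun n => ω (n + (firstMark ω + 1))

lemma epoch_succ_sub (n : ℕ) (ω : MarkedGaps) : epoch (n + 1) ω - epoch n ω = (ω n).1 := by
  simp [epoch, Finset.sum_range_succ]

lemma epoch_add (m n : ℕ) (ω : MarkedGaps) :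
    epoch (n + m) ω = epoch m ω + epoch n fun j => ω (j + m) := by
  simp only [epoch, add_comm _ m, Finset.sum_range_add]

lemma measurable_epoch (n : ℕ) : Measurable (epoch n) := by
  unfold epoch
  fun_prop

lemma measurable_mark (n : ℕ) : Measurable (mark n) := by
  unfold mark
  fun_prop

lemma measurable_firstMark : Measurable firstMark :=
  measurable_nth_zero.comp (measurable_pi_lambda _ measurable_mark)

lemma retained_succ_sub {ω : MarkedGaps} (hω : ∃ᶠ n in atTop, mark n ω = true) (k : ℕ) :
    retained epoch mark (k + 1) ω - retained epoch mark k ω = firstRetained (afterMark^[k] ω) := by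
  induction k generalizing ω with
  | zero => simp [retained, firstRetained, firstMark, epoch]
  | succ k ih =>
    have hshift (k : ℕ) : retained epoch mark (k + 1) ω
        = firstRetained ω + retained epoch mark k (afterMark ω) := by
      cases k with
      | zero => simp [retained, firstRetained, firstMark, epoch]
      | succ k =>
        rw [retained, nth_succ_eq_nth_add hω, add_right_comm, epoch_add]
        rfl
    rw [hshift, hshift, add_sub_add_left_eq_sub, Function.iterate_succ_apply,
      ih (ω := afterMark ω) ((frequently_atTop_add_iff _).2 hω)]

variable {κ : Measure (ℝ × Bool)} [IsProbabilityMeasure κ]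

lemma iIndepFun_mark : iIndepFun mark (Measure.infinitePi fun _ => κ) :=
  iIndepFun_infinitePi (X := fun _ => Prod.snd) fun _ => measurable_snd

lemma measure_mark (n : ℕ) :
    (Measure.infinitePi fun _ => κ) {ω | mark n ω = true} = κ {x | x.2 = true} :=
  (measurePreserving_eval_infinitePi (fun _ => κ) n).measure_preimage
    (measurable_snd (.singleton true)).nullMeasurableSet

lemma ae_frequently_mark (hκ : κ {x | x.2 = true} ≠ 0) :
    ∀ᵐ ω ∂Measure.infinitePi fun _ => κ, ∃ᶠ n in atTop, mark n ω = true :=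
  ae_frequently_eq_true measurable_mark iIndepFun_mark hκ measure_mark

lemma indepFun_firstMark_epoch (hκ : κ {x | x.2 = true} ≠ 0) (m : ℕ) :
    IndepFun (fun ω => (firstMark ω = m, epoch (m + 1) ω))
      (fun (ω : MarkedGaps) n => ω (n + (m + 1))) (Measure.infinitePi fun _ => κ) := by
  let first (x : Finset.range (m + 1) → ℝ × Bool) : Prop := ∀ i, (x i).2 = decide (i.1 = m)
  have hfirst : Measurable first :=
    Measurable.forall fun i => measurableSet_setOfPred.1
      ((measurable_pi_apply i).snd (measurableSet_singleton _))
  have hindep := (indepFun_range_add_right_infinitePi (fun _ => κ) (m + 1)).comp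
    (φ := fun x => ((first x, ∑ i, (x i).1) : Prop × ℝ)) (hfirst.prodMk (by fun_prop))
    measurable_id
  refine hindep.congr ?_ (by rfl)
  filter_upwards [ae_frequently_mark hκ] with ω hω
  have hmark : first (fun i => ω i) ↔ firstMark ω = m := by
    rw [firstMark, nth_eq_true_zero_eq_iff hω.exists]
    exact Subtype.forall
  simp only [Function.comp_apply, hmark, epoch]
  rw [Finset.sum_coe_sort (Finset.range (m + 1)) fun i => (ω i).1]

lemma measurePreserving_afterMark (hκ : κ {x | x.2 = true} ≠ 0) :
    MeasurePreserving afterMark (Measure.infinitePi fun _ => κ) (Measure.infinitePi fun _ => κ) :=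
  measurePreserving_randomIndex measurable_firstMark
    (fun m => measurePreserving_add_right_infinitePi κ (m + 1))
    fun m => (indepFun_firstMark_epoch hκ m).comp measurable_fst measurable_id

lemma indepFun_firstRetained_afterMark (hκ : κ {x | x.2 = true} ≠ 0) :
    IndepFun firstRetained afterMark (Measure.infinitePi fun _ => κ) :=
  indepFun_randomIndex measurable_firstMark
    (fun m => measurePreserving_add_right_infinitePi κ (m + 1)) (indepFun_firstMark_epoch hκ)

lemma measurable_firstRetained : Measurable firstRetained :=
  measurable_randomIndex measurable_firstMark fun m => measurable_epoch (m + 1)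

theorem isRenewal_retained (hκ : κ {x | x.2 = true} ≠ 0) {G : ProbabilityMeasure ℝ}
    (hG : HasLaw firstRetained (G : Measure ℝ) (Measure.infinitePi fun _ => κ)) :
    IsRenewal (Measure.infinitePi fun _ => κ) G (retained epoch mark) := by
  have hS := measurePreserving_afterMark hκ
  have hgap (k : ℕ) : (fun ω => retained epoch mark (k + 1) ω - retained epoch mark k ω)
      =ᵐ[Measure.infinitePi fun _ => κ] firstRetained ∘ afterMark^[k] := by
    filter_upwards [ae_frequently_mark hκ] with ω hω using retained_succ_sub hω k
  exact ⟨fun _ => by simp [retained, epoch],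
    fun k => (hG.comp (hS.iterate k).hasLaw).congr (hgap k),
    (iIndepFun_congr hgap).2 (iIndepFun_comp_iterate measurable_firstRetained hS
      (indepFun_firstRetained_afterMark hκ))⟩

lemma isRenewal_epoch (F : ProbabilityMeasure ℝ) (β : Measure Bool) [IsProbabilityMeasure β] :
    IsRenewal (Measure.infinitePi fun _ => (F : Measure ℝ).prod β) F epoch := by
  refine ⟨fun _ => by simp [epoch], fun n => ?_, ?_⟩
  · simp only [epoch_succ_sub]
    exact (measurePreserving_fst.comp (measurePreserving_eval_infinitePi _ n)).hasLaw
  · simp only [epoch_succ_sub]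
    exact iIndepFun_infinitePi (X := fun _ => Prod.fst) fun _ => measurable_fst

end MarkedGaps

theorem exists_isThinning {p : ℝ} (hp : 0 < p) (hp1 : p ≤ 1) (F : ProbabilityMeasure ℝ) :
    ∃ G, IsThinning p F G := by
  let β : Measure Bool :=
    ENNReal.ofReal p • Measure.dirac true + ENNReal.ofReal (1 - p) • Measure.dirac false
  have : IsProbabilityMeasure β :=
    ⟨by simp [β, ← ENNReal.ofReal_add hp.le (sub_nonneg.2 hp1)]⟩
  let κ := (F : Measure ℝ).prod β
  have hκ : κ {x | x.2 = true} = ENNReal.ofReal p :=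
    (measurePreserving_snd.measure_preimage (MeasurableSet.singleton true).nullMeasurableSet).trans
      (by simp [β])
  have hκ0 : κ {x | x.2 = true} ≠ 0 := by simpa [hκ] using hp
  let P : Measure MarkedGaps := Measure.infinitePi fun _ => κ
  let G : ProbabilityMeasure ℝ := ⟨P.map MarkedGaps.firstRetained,
    Measure.isProbabilityMeasure_map MarkedGaps.measurable_firstRetained.aemeasurable⟩
  have hindep : IndepFun (fun ω n => MarkedGaps.mark n ω) (fun ω n => MarkedGaps.epoch n ω) P :=
    (indepFun_fst_snd_infinitePi (fun _ => (F : Measure ℝ)) fun _ => β).symm.comp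
      (ψ := fun x n => ∑ j ∈ Finset.range n, x j) measurable_id (by fun_prop)
  exact ⟨G, MarkedGaps, inferInstance, P, MarkedGaps.epoch, MarkedGaps.mark, inferInstance,
    MarkedGaps.measurable_epoch, MarkedGaps.isRenewal_epoch F β, MarkedGaps.measurable_mark,
    fun n => (MarkedGaps.measure_mark n).trans hκ, MarkedGaps.iIndepFun_mark, hindep,
    MarkedGaps.isRenewal_retained hκ0
      ⟨MarkedGaps.measurable_firstRetained.aemeasurable, rfl⟩⟩

/-! ### Geometric infinite divisibility and exponents -/

section CharFun

variable {μ ν : ProbabilityMeasure ℝ}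

theorem exists_tendsto_of_tendsto_charFun {ν : ℕ → ProbabilityMeasure ℝ} {f : ℝ → ℂ}
    (hf : ContinuousAt f 0)
    (h : ∀ t, Tendsto (fun n => charFun (ν n : Measure ℝ) t) atTop (𝓝 (f t))) :
    ∃ μ : ProbabilityMeasure ℝ, charFun (μ : Measure ℝ) = f ∧ Tendsto ν atTop (𝓝 μ) := by
  have htight : IsTightMeasureSet {((m : ProbabilityMeasure ℝ) : Measure ℝ) | m ∈ Set.range ν} := by
    convert! isTightMeasureSet_of_tendsto_charFun hf h using 1
    ext
    simp
  have hcompact := isCompact_closure_of_isTightMeasureSet htight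
  obtain ⟨μ, -, φ, hφ, hμ⟩ := hcompact.isSeqCompact fun n => subset_closure (Set.mem_range_self n)
  have hμf : charFun (μ : Measure ℝ) = f := funext fun t => tendsto_nhds_unique
    (ProbabilityMeasure.tendsto_iff_tendsto_charFun.1 hμ t) ((h t).comp hφ.tendsto_atTop)
  exact ⟨μ, hμf, ProbabilityMeasure.tendsto_iff_tendsto_charFun.2 fun t => hμf ▸ h t⟩

lemma eq_of_charFun_eq (h : ∀ t, charFun (μ : Measure ℝ) t = charFun (ν : Measure ℝ) t) :
    μ = ν := by
  have hμν : (μ : Measure ℝ) = ν := Measure.ext_of_charFun (funext h)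
  exact Subtype.ext hμν

lemma one_sub_re_charFun_nonneg (ν : ProbabilityMeasure ℝ) (t : ℝ) :
    0 ≤ (1 - charFun (ν : Measure ℝ) t).re := by
  simpa using (Complex.re_le_norm _).trans (norm_charFun_le_one t)

lemma exists_charFun_eq_sum {ι : Type*} [Fintype ι] {w : ι → ℝ} (hw : ∀ i, 0 ≤ w i)
    (hw1 : ∑ i, w i = 1) (ν : ι → ProbabilityMeasure ℝ) :
    ∃ ρ : ProbabilityMeasure ℝ, ∀ t,
      charFun (ρ : Measure ℝ) t = ∑ i, w i * charFun (ν i : Measure ℝ) t := by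
  have hprob : IsProbabilityMeasure (∑ i, ENNReal.ofReal (w i) • (ν i : Measure ℝ)) := ⟨by
    simp [← ENNReal.ofReal_sum_of_nonneg fun i _ => hw i, hw1]⟩
  refine ⟨⟨_, hprob⟩, fun t => ?_⟩
  have hint (i : ι) : Integrable (fun x : ℝ => Complex.exp (t * x * Complex.I))
      (ENNReal.ofReal (w i) • (ν i : Measure ℝ)) :=
    (Integrable.of_bound (C := 1) (by fun_prop) (.of_forall fun x => by
      simp [Complex.norm_exp])).smul_measure ENNReal.ofReal_ne_top
  simp only [ProbabilityMeasure.coe_mk, charFun_apply_real]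
  rw [integral_finsetSum_measure fun i _ => hint i]
  refine Finset.sum_congr rfl fun i _ => ?_
  rw [integral_smul_measure, ENNReal.toReal_ofReal (hw i), Complex.real_smul]

end CharFun

section Thinning

variable {p : ℝ} {μ ν : ProbabilityMeasure ℝ}

lemma one_sub_mul_charFun_ne_zero (hp : 0 < p) (hp1 : p ≤ 1) (t : ℝ) :
    1 - (1 - (p : ℂ)) * charFun (ν : Measure ℝ) t ≠ 0 := fun h => by
  have hre := congrArg Complex.re h
  have hcast : (1 - (p : ℂ)) = ((1 - p : ℝ) : ℂ) := by push_cast; rfl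
  have hν := one_sub_re_charFun_nonneg ν t
  rw [hcast, Complex.sub_re, Complex.re_ofReal_mul, Complex.zero_re] at hre
  rw [Complex.sub_re] at hν
  rw [Complex.one_re] at hre hν
  nlinarith

lemma isThinning_of_charFun_mul (hp : 0 < p) (hp1 : p ≤ 1)
    (h : ∀ t, charFun (μ : Measure ℝ) t * (1 - (1 - p) * charFun (ν : Measure ℝ) t)
      = p * charFun (ν : Measure ℝ) t) : IsThinning p ν μ := by
  obtain ⟨G, hG⟩ := exists_isThinning hp hp1 ν
  have hGμ : G = μ := eq_of_charFun_eq fun t =>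
    mul_right_cancel₀ (one_sub_mul_charFun_ne_zero hp hp1 t)
      (((hG.isGeomSum hp).charFun_mul hp t).trans (h t).symm)
  exact hGμ ▸ hG

lemma isGeomSum_of_charFun_mul (hp : 0 < p) (hp1 : p ≤ 1)
    (h : ∀ t, charFun (μ : Measure ℝ) t * (1 - (1 - p) * charFun (ν : Measure ℝ) t)
      = p * charFun (ν : Measure ℝ) t) : IsGeomSum p ν μ :=
  (isThinning_of_charFun_mul hp hp1 h).isGeomSum hp

lemma isThinning_iff_isGeomSum (hp : 0 < p) : IsThinning p ν μ ↔ IsGeomSum p ν μ :=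
  ⟨fun h => h.isGeomSum hp, fun h => isThinning_of_charFun_mul hp h.le_one (h.charFun_mul hp)⟩

lemma exists_isGeomSum (hp : 0 < p) (hp1 : p ≤ 1) (ν : ProbabilityMeasure ℝ) :
    ∃ μ, IsGeomSum p ν μ :=
  (exists_isThinning hp hp1 ν).imp fun _ h => h.isGeomSum hp

end Thinning

/-- The functions `θ` such that `1 / (1 + p θ)` is a characteristic function for all `p ∈ (0, 1]`.
They are the exponents of the infinitely divisible laws, with characteristic functions
`exp (-θ)`. -/
def IsGeomExponent (θ : ℝ → ℂ) : Prop :=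
  ∀ p : ℝ, 0 < p → p ≤ 1 → ∃ ρ : ProbabilityMeasure ℝ, ∀ t,
    charFun (ρ : Measure ℝ) t * (1 + p * θ t) = 1

namespace IsGeomExponent

variable {θ : ℝ → ℂ}

lemma re_nonneg (hθ : IsGeomExponent θ) (t : ℝ) : 0 ≤ (θ t).re := by
  have hpos (n : ℕ) : 0 ≤ 2 * (θ t).re + 1 / ((n : ℝ) + 1) * Complex.normSq (θ t) := by
    have hp : (0 : ℝ) < 1 / (n + 1) := Nat.one_div_pos_of_nat
    obtain ⟨ρ, hρ⟩ := hθ _ hp (by simpa using Nat.one_div_le_one_div (α := ℝ) n.zero_le)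
    set p : ℝ := 1 / (n + 1)
    have hnorm : 1 ≤ Complex.normSq (1 + p * θ t) := by
      have h := congrArg norm (hρ t)
      rw [norm_mul, norm_one] at h
      rw [Complex.normSq_eq_norm_sq]
      nlinarith [norm_charFun_le_one (μ := (ρ : Measure ℝ)) t, norm_nonneg (1 + p * θ t)]
    rw [Complex.normSq_add, map_one, Complex.normSq_mul, Complex.normSq_ofReal] at hnorm
    simp only [map_mul, Complex.conj_ofReal, one_mul, Complex.re_ofReal_mul, Complex.conj_re]
      at hnorm
    nlinarith
  have hlim := (tendsto_one_div_add_atTop_nhds_zero_nat (𝕜 := ℝ)).mul_const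
    (Complex.normSq (θ t)) |>.const_add (2 * (θ t).re)
  have := ge_of_tendsto' hlim hpos
  linarith

lemma one_add_ne_zero (hθ : IsGeomExponent θ) (t : ℝ) : 1 + θ t ≠ 0 := fun h => by
  have hre := congrArg Complex.re h
  rw [Complex.add_re, Complex.one_re, Complex.zero_re] at hre
  linarith [hθ.re_nonneg t]

lemma exists_charFun_eq_inv (hθ : IsGeomExponent θ) :
    ∃ μ : ProbabilityMeasure ℝ, ∀ t, charFun (μ : Measure ℝ) t = (1 + θ t)⁻¹ :=
  (hθ 1 one_pos le_rfl).imp fun μ hμ t => eq_inv_of_mul_eq_one_left (by simpa using hμ t)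

theorem exists_tendsto_mul_one_sub_charFun (hθ : IsGeomExponent θ) :
    ∃ ν : ℕ → ProbabilityMeasure ℝ, ∀ t,
      Tendsto (fun n : ℕ => ((n : ℂ) + 1) * (1 - charFun (ν n : Measure ℝ) t)) atTop
        (𝓝 (θ t)) := by
  choose ν hν using fun n : ℕ => hθ _ Nat.one_div_pos_of_nat
    (by simpa using Nat.one_div_le_one_div (α := ℝ) n.zero_le)
  refine ⟨ν, fun t => ?_⟩
  have hone : Tendsto (fun n : ℕ => 1 + 1 / ((n : ℂ) + 1) * θ t) atTop (𝓝 1) := by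
    simpa using (tendsto_one_div_add_atTop_nhds_zero_nat.mul_const (θ t)).const_add 1
  have hlim := (hone.inv₀ one_ne_zero).const_mul (θ t)
  rw [inv_one, mul_one] at hlim
  refine hlim.congr fun n => ?_
  have h := hν n t
  push_cast at h
  rw [← eq_inv_of_mul_eq_one_left h]
  have : (n : ℂ) + 1 ≠ 0 := n.cast_add_one_ne_zero
  field_simp at h
  linear_combination h

theorem exists_tendsto_of_tendsto {θs : ℕ → ℝ → ℂ} (hθs : ∀ n, IsGeomExponent (θs n))
    (hθ : IsGeomExponent θ) (hlim : ∀ t, Tendsto (fun n => θs n t) atTop (𝓝 (θ t)))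
    {μ : ProbabilityMeasure ℝ} (hμ : ∀ t, charFun (μ : Measure ℝ) t = (1 + θ t)⁻¹) :
    ∃ η : ℕ → ProbabilityMeasure ℝ,
      (∀ n t, charFun (η n : Measure ℝ) t = (1 + θs n t)⁻¹) ∧ Tendsto η atTop (𝓝 μ) := by
  choose η hη using fun n => (hθs n).exists_charFun_eq_inv
  refine ⟨η, hη, ProbabilityMeasure.tendsto_iff_tendsto_charFun.2 fun t => ?_⟩
  simp only [hη, hμ]
  exact ((hlim t).const_add 1).inv₀ (hθ.one_add_ne_zero t)

end IsGeomExponent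

theorem isGID_of_tendsto_inv {θ : ℕ → ℝ → ℂ} (hθ : ∀ n, IsGeomExponent (θ n))
    {μ : ProbabilityMeasure ℝ}
    (hlim : ∀ t, Tendsto (fun n => (1 + θ n t)⁻¹) atTop (𝓝 (charFun (μ : Measure ℝ) t))) :
    IsGID μ := by
  intro p hp hp1
  choose ν hν using fun n => hθ n p hp hp1.le
  set g := charFun (μ : Measure ℝ)
  have hre (t : ℝ) : 0 ≤ (g t).re :=
    ge_of_tendsto' ((Complex.continuous_re.tendsto _).comp (hlim t)) fun n => by
      rw [Function.comp_apply, Complex.inv_re, Complex.add_re, Complex.one_re]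
      exact div_nonneg (by linarith [(hθ n).re_nonneg t]) (Complex.normSq_nonneg _)
  have hne (t : ℝ) : (p : ℂ) + (1 - p) * g t ≠ 0 := fun h => by
    have h0 := congrArg Complex.re h
    rw [← Complex.ofReal_one, ← Complex.ofReal_sub, Complex.add_re, Complex.re_ofReal_mul,
      Complex.ofReal_re, Complex.zero_re] at h0
    nlinarith [hre t]
  have hνlim (t : ℝ) : Tendsto (fun n => charFun (ν n : Measure ℝ) t) atTop
      (𝓝 (g t / (p + (1 - p) * g t))) := by
    refine ((hlim t).div (((hlim t).const_mul _).const_add _) (hne t)).congr fun n => ?_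
    have h1 := (hθ n).one_add_ne_zero t
    rw [Pi.div_apply, eq_inv_of_mul_eq_one_left (hν n t)]
    field_simp
    ring_nf
  obtain ⟨ρ, hρ, -⟩ := exists_tendsto_of_tendsto_charFun
    (continuous_charFun.div (by fun_prop) hne).continuousAt hνlim
  refine ⟨ρ, isGeomSum_of_charFun_mul hp hp1.le fun t => ?_⟩
  have := hne t
  have hρt : charFun (ρ : Measure ℝ) t = g t / (p + (1 - p) * g t) := congrFun hρ t
  rw [hρt]
  field_simp
  ring

lemma IsGeomSum.charFun_mul_add {p : ℝ} (hp : 0 < p) {ν μ : ProbabilityMeasure ℝ}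
    (h : IsGeomSum p ν μ) (t : ℝ) :
    charFun (ν : Measure ℝ) t * (p + (1 - p) * charFun (μ : Measure ℝ) t)
      = charFun (μ : Measure ℝ) t := by
  linear_combination -h.charFun_mul hp t

lemma IsGID.exists_charFun_eq_indicator {μ : ProbabilityMeasure ℝ} (hμ : IsGID μ) :
    ∃ ρ : ProbabilityMeasure ℝ,
      charFun (ρ : Measure ℝ) = {t | charFun (μ : Measure ℝ) t ≠ 0}.indicator 1 := by
  set g := charFun (μ : Measure ℝ) with hg
  obtain ⟨p, -, hp, hp0⟩ := exists_seq_strictAnti_tendsto' (zero_lt_one (α := ℝ))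
  choose ν hν using fun n => hμ (p n) (hp n).1 (hp n).2
  have hlim (t : ℝ) : Tendsto (fun n => charFun (ν n : Measure ℝ) t) atTop
      (𝓝 ({t | g t ≠ 0}.indicator 1 t)) := by
    by_cases ht : g t = 0
    · rw [Set.indicator_of_notMem (by simpa using ht)]
      refine tendsto_const_nhds.congr fun n => ?_
      have h := (hν n).charFun_mul (hp n).1 t
      rw [← hg, ht, zero_mul, zero_eq_mul] at h
      exact (h.resolve_left (mod_cast (hp n).1.ne')).symm
    · rw [Set.indicator_of_mem (by simpa using ht), Pi.one_apply]
      have hden : Tendsto (fun n => (p n : ℂ) + (1 - p n) * g t) atTop (𝓝 (g t)) := by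
        have := ((Complex.continuous_ofReal.tendsto 0).comp hp0)
        simpa using this.add ((this.const_sub 1).mul_const (g t))
      have h := (tendsto_const_nhds (x := g t)).div hden ht
      rw [div_self ht] at h
      refine h.congr' ?_
      filter_upwards [hden.eventually_ne ht] with n hn
      exact div_eq_of_eq_mul hn ((hν n).charFun_mul_add (hp n).1 t).symm
  have hg0 : {t | g t ≠ 0} ∈ 𝓝 0 :=
    continuous_charFun.continuousAt.eventually_ne (by simp)
  have hcont : ContinuousAt ({t | g t ≠ 0}.indicator (1 : ℝ → ℂ)) 0 :=
    (continuousAt_const (y := 1)).congr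
      (eventuallyEq_of_mem hg0 fun t ht => by rw [Set.indicator_of_mem ht, Pi.one_apply])
  exact (exists_tendsto_of_tendsto_charFun hcont hlim).imp fun _ => And.left

theorem IsGID.charFun_ne_zero {μ : ProbabilityMeasure ℝ} (hμ : IsGID μ) (t : ℝ) :
    charFun (μ : Measure ℝ) t ≠ 0 := by
  obtain ⟨ρ, hρ⟩ := hμ.exists_charFun_eq_indicator
  have hclosed : IsClosed {t | charFun (μ : Measure ℝ) t ≠ 0} := by
    convert! isClosed_eq (continuous_charFun (μ := (ρ : Measure ℝ))) (continuous_const (y := 1))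
      using 1
    ext t
    simp [hρ, Set.indicator_apply]
  have hclopen : IsClopen {t | charFun (μ : Measure ℝ) t ≠ 0} :=
    ⟨hclosed, isOpen_ne_fun continuous_charFun continuous_const⟩
  exact (hclopen.eq_univ ⟨0, by simp⟩).symm.subset (Set.mem_univ t)

lemma IsGID.exists_isGeomSum {μ : ProbabilityMeasure ℝ} (hμ : IsGID μ) {p : ℝ} (hp : 0 < p)
    (hp1 : p ≤ 1) : ∃ ν, IsGeomSum p ν μ := by
  rcases hp1.lt_or_eq with hp1 | rfl
  · exact hμ p hp hp1
  · exact ⟨μ, isGeomSum_of_charFun_mul one_pos le_rfl fun t => by simp⟩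

theorem isGID_iff {μ : ProbabilityMeasure ℝ} :
    IsGID μ ↔ (∀ t, charFun (μ : Measure ℝ) t ≠ 0) ∧
      IsGeomExponent fun t => (charFun (μ : Measure ℝ) t)⁻¹ - 1 := by
  refine ⟨fun hμ => ⟨hμ.charFun_ne_zero, fun p hp hp1 => ?_⟩, fun ⟨hne, hθ⟩ p hp hp1 => ?_⟩
  · obtain ⟨ν, hν⟩ := hμ.exists_isGeomSum hp hp1
    refine ⟨ν, fun t => ?_⟩
    have := hμ.charFun_ne_zero t
    field_simp
    linear_combination hν.charFun_mul_add hp t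
  · obtain ⟨ν, hν⟩ := hθ p hp hp1.le
    refine ⟨ν, isGeomSum_of_charFun_mul hp hp1.le fun t => ?_⟩
    have h := hν t
    have := hne t
    field_simp at h
    linear_combination -h

theorem isGID_of_tendsto {η : ℕ → ProbabilityMeasure ℝ} (hη : ∀ n, IsGID (η n))
    {μ : ProbabilityMeasure ℝ} (hlim : Tendsto η atTop (𝓝 μ)) : IsGID μ :=
  isGID_of_tendsto_inv (fun n => (isGID_iff.1 (hη n)).2) fun t => by
    simpa using ProbabilityMeasure.tendsto_iff_tendsto_charFun.1 hlim t

lemma mem_gidClass_iff {I : Set ℝ} {μ : ProbabilityMeasure ℝ} :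
    μ ∈ gidClass I ↔ CarriedBy I μ ∧ IsGID μ :=
  and_congr_right fun _ =>
    ⟨fun h => h.elim id fun ⟨_, hη, hlim⟩ => isGID_of_tendsto (fun n => (hη n).2) hlim, Or.inl⟩

theorem gidClass_eq_coxRenewalClass {I : Set ℝ} (hI : MeasurableSet I) :
    gidClass I = coxRenewalClass I := by
  ext μ
  rw [mem_gidClass_iff]
  refine and_congr_right fun hμ => forall₃_congr fun p hp _ => exists_congr fun ν => ?_
  rw [isThinning_iff_isGeomSum hp]
  exact ⟨fun h => ⟨h.carriedBy hp hI hμ, h⟩, And.right⟩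

lemma exists_charFun_mul_one_add {c : ℝ} (hc : 0 ≤ c) (ν : ProbabilityMeasure ℝ) :
    ∃ ρ : ProbabilityMeasure ℝ, ∀ t,
      charFun (ρ : Measure ℝ) t * (1 + c * (1 - charFun (ν : Measure ℝ) t)) = 1 := by
  have hc1 : 0 < 1 + c := by linarith
  set q : ℝ := 1 / (1 + c)
  have hq0 : 0 < q := by positivity
  have hq1 : q ≤ 1 := (div_le_one hc1).2 (by linarith)
  obtain ⟨G, hG⟩ := exists_isGeomSum hq0 hq1 ν
  obtain ⟨ρ, hρ⟩ : ∃ ρ : ProbabilityMeasure ℝ, ∀ t,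
      charFun (ρ : Measure ℝ) t = q + (1 - q) * charFun (G : Measure ℝ) t := by
    simpa [Fin.sum_univ_two] using exists_charFun_eq_sum (w := ![q, 1 - q])
      (Fin.forall_fin_two.2 ⟨hq0.le, sub_nonneg.2 hq1⟩) (by simp)
      ![⟨Measure.dirac 0, inferInstance⟩, G]
  refine ⟨ρ, fun t => ?_⟩
  have hcq : (q : ℂ) * (1 + c) = 1 := mod_cast one_div_mul_cancel hc1.ne'
  have hGt := hG.charFun_mul hq0 t
  have hq0' : (q : ℂ) ≠ 0 := mod_cast hq0.ne'
  rw [hρ]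
  refine mul_left_cancel₀ hq0' ?_
  set f := charFun (ν : Measure ℝ) t
  set a := charFun (G : Measure ℝ) t
  linear_combination (1 - f) * ((q : ℂ) + (1 - q) * a) * hcq + (1 - q) * hGt

theorem isGeomExponent_mul_one_sub_charFun {c : ℝ} (hc : 0 ≤ c) (ν : ProbabilityMeasure ℝ) :
    IsGeomExponent fun t => c * (1 - charFun (ν : Measure ℝ) t) := fun p hp _ => by
  simpa [mul_assoc] using exists_charFun_mul_one_add (mul_nonneg hp.le hc) ν

/-! ### Compound Poisson exponents -/

/-- The exponent `t ↦ ∑ j, l j (1 - exp (i β j t))` of a compound Poisson law that jumps by `β j`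
at rate `l j`. -/
noncomputable def jumpExponent {k : ℕ} (l β : Fin k → ℝ) (t : ℝ) : ℂ :=
  ∑ j, (l j : ℂ) * (1 - Complex.exp (Complex.I * β j * t))

/-- The laws with characteristic function `1 / (1 + θ)` for an exponent `θ` with finitely many
jumps. -/
def jumpLaws : Set (ProbabilityMeasure ℝ) :=
  {μ | ∃ (k : ℕ) (l β : Fin k → ℝ), (∀ j, 0 < l j) ∧
    ∀ t, charFun (μ : Measure ℝ) t = (1 + jumpExponent l β t)⁻¹}

lemma isGeomExponent_jumpExponent {k : ℕ} {l : Fin k → ℝ} (hl : ∀ j, 0 < l j) (β : Fin k → ℝ) :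
    IsGeomExponent (jumpExponent l β) := by
  set c := ∑ j, l j
  have hc : 0 ≤ c := Finset.sum_nonneg fun j _ => (hl j).le
  obtain ⟨ν, hν⟩ : ∃ ν : ProbabilityMeasure ℝ, ∀ t,
      jumpExponent l β t = c * (1 - charFun (ν : Measure ℝ) t) := by
    rcases isEmpty_or_nonempty (Fin k) with h | h
    · exact ⟨⟨Measure.dirac 0, inferInstance⟩, by simp [jumpExponent]⟩
    have hc0 : c ≠ 0 := (Finset.sum_pos (fun j _ => hl j) Finset.univ_nonempty).ne'
    obtain ⟨ν, hν⟩ := exists_charFun_eq_sum (w := fun j => l j / c)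
      (fun j => div_nonneg (hl j).le hc) (by rw [← Finset.sum_div, div_self hc0])
      fun j => ⟨Measure.dirac (β j), inferInstance⟩
    refine ⟨ν, fun t => ?_⟩
    have hc' : (c : ℂ) ≠ 0 := mod_cast hc0
    have hcl : (c : ℂ) = ∑ j, (l j : ℂ) := by simp [c]
    rw [hν, mul_sub, Finset.mul_sum, mul_one, hcl, ← Finset.sum_sub_distrib, jumpExponent]
    refine Finset.sum_congr rfl fun j _ => ?_
    rw [← hcl, Complex.ofReal_div, ← mul_assoc, mul_div_cancel₀ _ hc', ProbabilityMeasure.coe_mk,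
      charFun_dirac, mul_one_sub]
    congr 3
    simp only [RCLike.inner_apply, Real.ringHom_apply, Complex.ofReal_mul]
    ring
  exact funext hν ▸ isGeomExponent_mul_one_sub_charFun hc ν

lemma exists_jumpExponent_eq_sum (s : Finset ℝ) {w : ℝ → ℝ} (hw : ∀ y, 0 ≤ w y) :
    ∃ (k : ℕ) (l β : Fin k → ℝ), (∀ j, 0 < l j) ∧ ∀ t,
      jumpExponent l β t = ∑ y ∈ s, (w y : ℂ) * (1 - Complex.exp (Complex.I * y * t)) := by
  classical
  let e := (s.filter fun y => 0 < w y).equivFin.symm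
  refine ⟨_, fun j => w (e j), fun j => e j, fun j => (Finset.mem_filter.1 (e j).2).2, fun t => ?_⟩
  let f (y : ℝ) : ℂ := w y * (1 - Complex.exp (Complex.I * y * t))
  calc jumpExponent _ _ t = ∑ y : {y ∈ s | 0 < w y}, f y := Equiv.sum_comp e fun y => f y
    _ = ∑ y ∈ s with 0 < w y, f y := Finset.sum_coe_sort _ f
    _ = ∑ y ∈ s, f y := Finset.sum_filter_of_ne fun y _ hy =>
        (hw y).lt_of_ne fun h => hy (by simp [f, ← h])

lemma charFun_map (ν : ProbabilityMeasure ℝ) {D : ℝ → ℝ} (hD : Measurable D) (t : ℝ) :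
    charFun (ν.map hD.aemeasurable : Measure ℝ) t
      = ∫ x, Complex.exp (t * D x * Complex.I) ∂(ν : Measure ℝ) := by
  rw [charFun_apply_real]
  exact integral_map hD.aemeasurable (by fun_prop)

lemma exists_jumpExponent_eq_mul_one_sub_charFun {c : ℝ} (hc : 0 ≤ c) (ν : ProbabilityMeasure ℝ)
    (D : SimpleFunc ℝ ℝ) :
    ∃ (k : ℕ) (l β : Fin k → ℝ), (∀ j, 0 < l j) ∧ jumpExponent l β =
      fun t => c * (1 - charFun (ν.map D.measurable.aemeasurable : Measure ℝ) t) := by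
  obtain ⟨k, l, β, hl, h⟩ := exists_jumpExponent_eq_sum D.range
    (w := fun y => c * (ν : Measure ℝ).real (D ⁻¹' {y})) fun y => by positivity
  refine ⟨k, l, β, hl, funext fun t => ?_⟩
  have hint : Integrable (fun x => Complex.exp (t * D x * Complex.I)) (ν : Measure ℝ) :=
    Integrable.of_bound (C := 1) (by fun_prop) (.of_forall fun x => by simp [Complex.norm_exp])
  have hsum := SimpleFunc.map_integral (μ := (ν : Measure ℝ)) D
    (fun y : ℝ => 1 - Complex.exp (t * y * Complex.I))
    (SimpleFunc.integrable_of_isFiniteMeasure D) (by simp)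
  rw [SimpleFunc.integral_eq_integral _ (SimpleFunc.integrable_of_isFiniteMeasure _)] at hsum
  simp only [SimpleFunc.map_apply, Complex.real_smul] at hsum
  rw [integral_sub (integrable_const _) hint, ← charFun_map ν D.measurable t] at hsum
  simp only [integral_const, probReal_univ, one_smul] at hsum
  rw [h, hsum, Finset.mul_sum]
  refine Finset.sum_congr rfl fun y _ => ?_
  push_cast
  ring_nf

lemma exists_simpleFunc_tendsto_map (ν : ProbabilityMeasure ℝ) :
    ∃ D : ℕ → SimpleFunc ℝ ℝ, ∀ t,
      Tendsto (fun n => charFun (ν.map (D n).measurable.aemeasurable : Measure ℝ) t) atTop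
        (𝓝 (charFun (ν : Measure ℝ) t)) := by
  let D := SimpleFunc.approxOn id measurable_id Set.univ (0 : ℝ) (Set.mem_univ _)
  refine ⟨D, fun t => ?_⟩
  simp only [fun n => charFun_map ν (D n).measurable t, charFun_apply_real]
  refine tendsto_integral_of_dominated_convergence (fun _ => 1)
    (fun n => by have := (D n).measurable; fun_prop) (integrable_const 1)
    (fun n => .of_forall fun x => by simp [Complex.norm_exp])
    (.of_forall fun x => ?_)
  have hx := SimpleFunc.tendsto_approxOn measurable_id (Set.mem_univ (0 : ℝ)) (x := x) (by simp)
  have hexp : Continuous fun y : ℝ => Complex.exp (t * y * Complex.I) := by fun_prop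
  exact (hexp.tendsto x).comp hx

lemma mem_closure_jumpLaws {c : ℝ} (hc : 0 ≤ c) {μ ν : ProbabilityMeasure ℝ}
    (hμ : ∀ t, charFun (μ : Measure ℝ) t = (1 + c * (1 - charFun (ν : Measure ℝ) t))⁻¹) :
    μ ∈ closure jumpLaws := by
  obtain ⟨D, hD⟩ := exists_simpleFunc_tendsto_map ν
  obtain ⟨η, hη, hημ⟩ := (isGeomExponent_mul_one_sub_charFun hc ν).exists_tendsto_of_tendsto
    (fun n => isGeomExponent_mul_one_sub_charFun hc (ν.map (D n).measurable.aemeasurable))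
    (fun t => ((hD t).const_sub 1).const_mul _) hμ
  refine mem_closure_of_tendsto hημ (.of_forall fun n => ?_)
  obtain ⟨k, l, β, hl, h⟩ := exists_jumpExponent_eq_mul_one_sub_charFun hc ν (D n)
  exact ⟨k, l, β, hl, h ▸ hη n⟩

theorem isGID_iff_mem_closure_jumpLaws {μ : ProbabilityMeasure ℝ} :
    IsGID μ ↔ μ ∈ closure jumpLaws := by
  refine ⟨fun hμ => ?_, fun hμ => ?_⟩
  · have hθ := (isGID_iff.1 hμ).2
    obtain ⟨ν, hν⟩ := hθ.exists_tendsto_mul_one_sub_charFun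
    have hc (n : ℕ) : (0 : ℝ) ≤ n + 1 := by positivity
    obtain ⟨η, hη, hημ⟩ := hθ.exists_tendsto_of_tendsto
      (fun n => isGeomExponent_mul_one_sub_charFun (hc n) (ν n)) (by simpa using hν) (μ := μ)
      (by simp)
    exact isClosed_closure.mem_of_tendsto hημ
      (.of_forall fun n => mem_closure_jumpLaws (hc n) (hη n))
  · obtain ⟨η, hη, hημ⟩ := mem_closure_iff_seq_limit.1 hμ
    choose k l β hl hη using hη
    exact isGID_of_tendsto_inv (fun n => isGeomExponent_jumpExponent (hl n) (β n)) fun t => by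
      simpa only [hη] using ProbabilityMeasure.tendsto_iff_tendsto_charFun.1 hημ t

theorem gidClass_eq_charFunLimitClass (I : Set ℝ) : gidClass I = charFunLimitClass I := by
  ext μ
  rw [mem_gidClass_iff]
  refine and_congr_right fun _ => ⟨fun hμ => ?_, fun ⟨k, l, β, hl, hlim⟩ => ?_⟩
  · obtain ⟨η, hη, hημ⟩ := mem_closure_iff_seq_limit.1 (isGID_iff_mem_closure_jumpLaws.1 hμ)
    choose k l β hl hη using hη
    refine ⟨k, l, β, hl, fun t => ?_⟩
    simpa only [hη, jumpExponent, one_div] using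
      ProbabilityMeasure.tendsto_iff_tendsto_charFun.1 hημ t
  · exact isGID_of_tendsto_inv (fun n => isGeomExponent_jumpExponent (hl n) (β n)) fun t => by
      simpa only [jumpExponent, one_div] using hlim t

/-! ### Geometric sums of negligible summands -/

section Negligibility

variable {ν : ℕ → ProbabilityMeasure ℝ}

lemma tendsto_diracProba_zero_iff :
    Tendsto ν atTop (𝓝 (diracProba 0)) ↔
      ∀ ε > 0, Tendsto (fun n => (ν n : Measure ℝ) {x | ε < |x|}) atTop (𝓝 0) := by
  have hnull {s : Set ℝ} (hs : MeasurableSet s) (h0 : (0 : ℝ) ∉ s) :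
      ((diracProba 0 : ProbabilityMeasure ℝ) : Measure ℝ) s = 0 := by
    rw [diracProba, ProbabilityMeasure.coe_mk, Measure.dirac_apply' _ hs,
      Set.indicator_of_notMem h0]
  refine ⟨fun h ε hε => ?_, fun h => tendsto_of_forall_isOpen_le_liminf' fun G hG => ?_⟩
  · have hfrontier : ((diracProba 0 : ProbabilityMeasure ℝ) : Measure ℝ)
        (frontier {x | ε < |x|}) = 0 :=
      measure_mono_null (frontier_lt_subset_eq continuous_const continuous_abs)
        (hnull (measurableSet_eq_fun (by fun_prop) (by fun_prop)) (by simpa using hε.ne'))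
    have hlim := ProbabilityMeasure.tendsto_measure_of_null_frontier_of_tendsto' h hfrontier
    rwa [hnull (measurableSet_lt (by fun_prop) (by fun_prop)) (by simpa using hε.le)] at hlim
  · by_cases h0 : (0 : ℝ) ∈ G
    · obtain ⟨ε, hε, hεG⟩ := Metric.nhds_basis_closedBall.mem_iff.1 (hG.mem_nhds h0)
      have hle (n : ℕ) : 1 - (ν n : Measure ℝ) {x | ε < |x|} ≤ (ν n : Measure ℝ) G := by
        rw [tsub_le_iff_left, ← prob_add_prob_compl (μ := (ν n : Measure ℝ)) hG.measurableSet,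
          add_comm]
        gcongr
        exact fun x hx => lt_of_not_ge fun hxε => hx (hεG (by simpa using hxε))
      have hlim : Tendsto (fun n => 1 - (ν n : Measure ℝ) {x | ε < |x|}) atTop (𝓝 1) := by
        simpa using ENNReal.Tendsto.sub tendsto_const_nhds (h ε hε) (.inl ENNReal.one_ne_top)
      calc ((diracProba 0 : ProbabilityMeasure ℝ) : Measure ℝ) G
          ≤ liminf (fun n => 1 - (ν n : Measure ℝ) {x | ε < |x|}) atTop :=
            prob_le_one.trans hlim.liminf_eq.ge
        _ ≤ liminf (fun n => (ν n : Measure ℝ) G) atTop := liminf_le_liminf (.of_forall hle)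
    · rw [hnull hG.measurableSet h0]
      exact zero_le

end Negligibility

lemma mem_geomLimitClass_iff {I : Set ℝ} {μ : ProbabilityMeasure ℝ} :
    μ ∈ geomLimitClass I ↔ CarriedBy I μ ∧
      ∃ (ψ : ℝ → ℝ) (ν η : ℕ → ProbabilityMeasure ℝ),
        (∀ n, CarriedBy I (ν n)) ∧
        (∀ (n : ℕ) (u : ℝ), u ≤ 0 →
          mgf id (ν n : Measure ℝ) u = Real.exp (-(1 / ((n : ℝ) + 1) * ψ (-u)))) ∧
        Tendsto ν atTop (𝓝 (diracProba 0)) ∧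
        (∀ n : ℕ, IsGeomSum (1 / ((n : ℝ) + 1)) (ν n) (η n)) ∧
        Tendsto η atTop (𝓝 μ) := by
  refine and_congr_right fun _ => exists_congr fun ψ => ?_
  have hmgf (ρ : ProbabilityMeasure ℝ) (s : ℝ) :
      mgf id (ρ : Measure ℝ) (-s) = ∫ x, Real.exp (-(s * x)) ∂(ρ : Measure ℝ) := by
    simp [mgf]
  simp only [← tendsto_diracProba_zero_iff, ← hmgf]
  constructor
  · rintro ⟨ν, η, hI, hψ, hν, hη, hμ⟩
    refine ⟨fun n => ν (n + 1), fun n => η (n + 1), fun n => hI _ n.succ_pos, fun n u hu => ?_,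
      (tendsto_add_atTop_iff_nat 1).2 hν, fun n => ?_, (tendsto_add_atTop_iff_nat 1).2 hμ⟩
    · simpa using hψ _ n.succ_pos (-u) (by simpa using hu)
    · simpa using hη _ n.succ_pos
  · rintro ⟨ν, η, hI, hψ, hν, hη, hμ⟩
    refine ⟨fun n => ν (n - 1), fun n => η (n - 1), fun n _ => hI _, fun n hn s hs => ?_,
      (tendsto_add_atTop_iff_nat 1).1 hν, fun n hn => ?_, (tendsto_add_atTop_iff_nat 1).1 hμ⟩
    · obtain ⟨n, rfl⟩ := Nat.exists_eq_add_of_le' hn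
      simpa using hψ n (-s) (by simpa using hs)
    · obtain ⟨n, rfl⟩ := Nat.exists_eq_add_of_le' hn
      simpa using hη n

section HalfLine

variable {μ ν : ProbabilityMeasure ℝ} {u : ℝ}

lemma integrable_exp_mul_of_carriedBy_Ici (hμ : CarriedBy (Set.Ici 0) μ) (hu : u ≤ 0) :
    Integrable (fun x => Real.exp (u * x)) (μ : Measure ℝ) :=
  .of_bound (by fun_prop) 1 (hμ.mono fun x (hx : 0 ≤ x) => by
    simpa using mul_nonpos_of_nonpos_of_nonneg hu hx)

lemma carriedBy_of_tendsto {F : Set ℝ} (hF : IsClosed F) {ρ : ℕ → ProbabilityMeasure ℝ}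
    (hρ : ∀ n, CarriedBy F (ρ n)) (hlim : Tendsto ρ atTop (𝓝 μ)) : CarriedBy F μ := by
  have h := ProbabilityMeasure.le_liminf_measure_open_of_tendsto hlim hF.isOpen_compl
  have hnull (n : ℕ) : (ρ n : Measure ℝ) Fᶜ = 0 := hρ n
  simp only [hnull, liminf_const, nonpos_iff_eq_zero] at h
  exact h

lemma tendsto_mgf_of_tendsto {ρ : ℕ → ProbabilityMeasure ℝ} (hu : u ≤ 0)
    (hρ : ∀ n, CarriedBy (Set.Ici 0) (ρ n)) (hlim : Tendsto ρ atTop (𝓝 μ)) :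
    Tendsto (fun n => mgf id (ρ n : Measure ℝ) u) atTop (𝓝 (mgf id (μ : Measure ℝ) u)) := by
  have h := ProbabilityMeasure.tendsto_iff_forall_integral_tendsto.1 hlim
    (.ofNormedAddCommGroup (fun x => Real.exp (u * max x 0)) (by fun_prop) 1 fun x => by
      simpa using mul_nonpos_of_nonpos_of_nonneg hu (le_max_right x 0))
  have hmgf {ν : ProbabilityMeasure ℝ} (hν : CarriedBy (Set.Ici 0) ν) :
      ∫ x, Real.exp (u * max x 0) ∂(ν : Measure ℝ) = mgf id (ν : Measure ℝ) u :=
    integral_congr_ae (hν.mono fun x (hx : 0 ≤ x) => by simp [max_eq_left hx])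
  simpa only [BoundedContinuousFunction.coe_ofNormedAddCommGroup, hmgf (hρ _),
    hmgf (carriedBy_of_tendsto isClosed_Ici hρ hlim)] using h

lemma tendsto_mgf_atBot (hμ : CarriedBy (Set.Ici 0) μ) :
    Tendsto (mgf id (μ : Measure ℝ)) atBot (𝓝 ((μ : Measure ℝ).real {0})) := by
  have hlim := tendsto_integral_filter_of_dominated_convergence (μ := (μ : Measure ℝ))
    (l := atBot) (F := fun u x => Real.exp (u * x)) (f := ({0} : Set ℝ).indicator 1) 1
    (.of_forall fun u => by fun_prop)
    (by
      filter_upwards [eventually_le_atBot 0] with u hu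
      filter_upwards [hμ] with x hx
      simpa using mul_nonpos_of_nonpos_of_nonneg hu hx)
    (integrable_const 1)
    (by
      filter_upwards [hμ] with x (hx : 0 ≤ x)
      rcases hx.eq_or_lt with rfl | hx
      · simp
      · rw [Set.indicator_of_notMem (by simpa using hx.ne')]
        exact Real.tendsto_exp_atBot.comp (tendsto_id.atBot_mul_const hx))
  rwa [integral_indicator_one (.singleton 0)] at hlim

lemma carriedBy_Ioi_iff : CarriedBy (Set.Ioi 0) μ ↔
    CarriedBy (Set.Ici 0) μ ∧ Tendsto (mgf id (μ : Measure ℝ)) atBot (𝓝 0) := by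
  have hIoi : CarriedBy (Set.Ioi 0) μ ↔ CarriedBy (Set.Ici 0) μ ∧ (μ : Measure ℝ).real {0} = 0 := by
    have hne : (μ : Measure ℝ).real {0} = 0 ↔ ∀ᵐ x ∂(μ : Measure ℝ), x ≠ 0 := by
      rw [measureReal_eq_zero_iff, measure_eq_zero_iff_ae_notMem]
      simp
    rw [hne, CarriedBy, CarriedBy, ← eventually_and]
    simp only [Set.mem_Ioi, Set.mem_Ici, lt_iff_le_and_ne, ne_comm (a := (0 : ℝ))]
  rw [hIoi]
  refine and_congr_right fun hμ => ⟨fun h => h ▸ tendsto_mgf_atBot hμ, fun h => ?_⟩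
  exact tendsto_nhds_unique (tendsto_mgf_atBot hμ) h

end HalfLine

section ConvolutionRoots

variable {μ : ProbabilityMeasure ℝ} {c : ℝ}

lemma exists_complexMGF_eq_pow (ν : ProbabilityMeasure ℝ) (n : ℕ) :
    ∃ ρ : ProbabilityMeasure ℝ,
      (∀ z, complexMGF id (ρ : Measure ℝ) z = complexMGF id (ν : Measure ℝ) z ^ n) ∧
      (CarriedBy (Set.Ici 0) ν → CarriedBy (Set.Ici 0) ρ) := by
  let P : Measure (ℕ → ℝ) := Measure.infinitePi fun _ => (ν : Measure ℝ)
  have hX (j : ℕ) : HasLaw (fun ω : ℕ → ℝ => ω j) (ν : Measure ℝ) P :=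
    (measurePreserving_eval_infinitePi (fun _ => (ν : Measure ℝ)) j).hasLaw
  have hindep : iIndepFun (fun (j : ℕ) (ω : ℕ → ℝ) => ω j) P :=
    iIndepFun_infinitePi (X := fun _ x => x) fun _ => measurable_id
  have hS : AEMeasurable (fun ω : ℕ → ℝ => ∑ j ∈ Finset.range n, ω j) P := by fun_prop
  refine ⟨⟨P.map _, Measure.isProbabilityMeasure_map hS⟩, fun z => ?_, fun hν => ?_⟩
  · rw [← complexMGF_sum_range hX hindep, ProbabilityMeasure.coe_mk, complexMGF_id_map hS]
  · have hpos : ∀ᵐ ω ∂P, ∀ j, 0 ≤ ω j := ae_all_iff.2 fun j =>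
      ((hX j).ae_iff (measurableSet_setOfPred.1 measurableSet_Ici)).2 hν
    exact (ae_map_iff hS measurableSet_Ici).2
      (hpos.mono fun ω hω => Finset.sum_nonneg fun j _ => hω j)

lemma tendsto_complexMGF_pow (hc : 0 < c) {ν : ℕ → ProbabilityMeasure ℝ}
    (hν : ∀ n : ℕ, IsGeomSum (c / ((n : ℝ) + 1)) (ν n) μ) {z : ℂ}
    (hz : ∀ᵐ x : ℝ ∂(μ : Measure ℝ), z.re * x ≤ 0) (hne : complexMGF id (μ : Measure ℝ) z ≠ 0) :
    Tendsto (fun n : ℕ => complexMGF id (ν n : Measure ℝ) z ^ (n + 1)) atTop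
      (𝓝 (Complex.exp (-(c * ((complexMGF id (μ : Measure ℝ) z)⁻¹ - 1))))) := by
  set θ := (complexMGF id (μ : Measure ℝ) z)⁻¹ - 1 with hθ
  have hinv (n : ℕ) : complexMGF id (ν n : Measure ℝ) z = (1 + c * θ / (n + 1 : ℕ))⁻¹ := by
    have hp : 0 < c / ((n : ℝ) + 1) := by positivity
    have hνz : ∀ᵐ x : ℝ ∂(ν n : Measure ℝ), z.re * x ≤ 0 :=
      (hν n).carriedBy hp (I := {x | z.re * x ≤ 0})
        (measurableSet_le (by fun_prop) (by fun_prop)) hz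
    have h := (hν n).complexMGF_mul hp hνz
    refine eq_inv_of_mul_eq_one_left ?_
    have : (n : ℂ) + 1 ≠ 0 := n.cast_add_one_ne_zero
    rw [hθ]
    push_cast at h ⊢
    field_simp at h ⊢
    linear_combination -h
  have hexp := (tendsto_add_atTop_iff_nat 1).2 (Complex.tendsto_one_add_div_pow_exp (c * θ))
  rw [Complex.exp_neg]
  simpa only [hinv, inv_pow] using hexp.inv₀ (Complex.exp_ne_zero _)

theorem IsGID.exists_charFun_eq_exp (hμ : IsGID μ) (hμ0 : CarriedBy (Set.Ici 0) μ) (hc : 0 < c)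
    (hc1 : c ≤ 1) :
    ∃ ρ : ProbabilityMeasure ℝ, CarriedBy (Set.Ici 0) ρ ∧
      (∀ t, charFun (ρ : Measure ℝ) t
        = Complex.exp (-(c * ((charFun (μ : Measure ℝ) t)⁻¹ - 1)))) ∧
      ∀ u ≤ 0, mgf id (ρ : Measure ℝ) u
        = Real.exp (-(c * ((mgf id (μ : Measure ℝ) u)⁻¹ - 1))) := by
  have hp (n : ℕ) : 0 < c / ((n : ℝ) + 1) := by positivity
  choose ν hν using fun n => hμ.exists_isGeomSum (hp n)
    (div_le_one_of_le₀ (by linarith [n.cast_nonneg (α := ℝ)]) (by positivity))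
  choose ρ hρ hρ0 using fun n => exists_complexMGF_eq_pow (ν n) (n + 1)
  have hρ0 (n : ℕ) : CarriedBy (Set.Ici 0) (ρ n) :=
    hρ0 n ((hν n).carriedBy (hp n) measurableSet_Ici hμ0)
  have hlim {z : ℂ} (hz : ∀ᵐ x : ℝ ∂(μ : Measure ℝ), z.re * x ≤ 0)
      (hne : complexMGF id (μ : Measure ℝ) z ≠ 0) := tendsto_complexMGF_pow hc hν hz hne
  simp only [← hρ] at hlim
  have hcont : Continuous fun t =>
      Complex.exp (-(c * ((charFun (μ : Measure ℝ) t)⁻¹ - 1))) := by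
    have hinv := (continuous_charFun (μ := (μ : Measure ℝ))).inv₀ hμ.charFun_ne_zero
    exact ((continuous_const.mul (hinv.sub continuous_const)).neg).cexp
  obtain ⟨ρ₀, hcharFun, hρ₀⟩ := exists_tendsto_of_tendsto_charFun (ν := ρ) hcont.continuousAt
    fun t => by
      simp only [← complexMGF_id_mul_I]
      exact hlim (.of_forall fun x => by simp)
        (by simpa only [complexMGF_id_mul_I] using hμ.charFun_ne_zero t)
  refine ⟨ρ₀, carriedBy_of_tendsto isClosed_Ici hρ0 hρ₀, congrFun hcharFun, fun u hu => ?_⟩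
  have hmgf := hlim (z := u) (hμ0.mono fun x hx => mul_nonpos_of_nonpos_of_nonneg hu hx)
    (by
      rw [complexMGF_ofReal]
      exact_mod_cast (mgf_pos (integrable_exp_mul_of_carriedBy_Ici hμ0 hu)).ne')
  simp only [complexMGF_ofReal] at hmgf
  exact_mod_cast tendsto_nhds_unique
    ((Complex.continuous_ofReal.tendsto _).comp (tendsto_mgf_of_tendsto hu hρ0 hρ₀)) hmgf

lemma carriedBy_Ioi_of_mgf_eq_exp {ρ : ProbabilityMeasure ℝ} (hμ : CarriedBy (Set.Ioi 0) μ)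
    (hρ : CarriedBy (Set.Ici 0) ρ) (hc : 0 < c)
    (hmgf : ∀ u ≤ 0, mgf id (ρ : Measure ℝ) u
      = Real.exp (-(c * ((mgf id (μ : Measure ℝ) u)⁻¹ - 1)))) : CarriedBy (Set.Ioi 0) ρ := by
  obtain ⟨hμ0, hlim⟩ := carriedBy_Ioi_iff.1 hμ
  have hpos : ∀ᶠ u in atBot, mgf id (μ : Measure ℝ) u ∈ Set.Ioi 0 :=
    (eventually_le_atBot 0).mono fun u hu => mgf_pos (integrable_exp_mul_of_carriedBy_Ici hμ0 hu)
  have hinv : Tendsto (fun u => c * ((mgf id (μ : Measure ℝ) u)⁻¹ - 1)) atBot atTop :=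
    (tendsto_atTop_add_const_right _ (-1) (Tendsto.inv_tendsto_nhdsGT_zero
      (tendsto_nhdsWithin_iff.2 ⟨hlim, hpos⟩))).const_mul_atTop hc
  refine carriedBy_Ioi_iff.2 ⟨hρ, (Real.tendsto_exp_neg_atTop_nhds_zero.comp hinv).congr' ?_⟩
  filter_upwards [eventually_le_atBot 0] with u hu
  exact (hmgf u hu).symm

theorem IsGID.exists_charFun_eq_exp_of_carriedBy {I : Set ℝ}
    (hI : I = Set.Ici 0 ∨ I = Set.Ioi 0) (hμ : IsGID μ) (hμI : CarriedBy I μ) (hc : 0 < c)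
    (hc1 : c ≤ 1) :
    ∃ ρ : ProbabilityMeasure ℝ, CarriedBy I ρ ∧
      (∀ t, charFun (ρ : Measure ℝ) t
        = Complex.exp (-(c * ((charFun (μ : Measure ℝ) t)⁻¹ - 1)))) ∧
      ∀ u ≤ 0, mgf id (ρ : Measure ℝ) u
        = Real.exp (-(c * ((mgf id (μ : Measure ℝ) u)⁻¹ - 1))) := by
  rcases hI with rfl | rfl
  · exact hμ.exists_charFun_eq_exp hμI hc hc1
  · obtain ⟨ρ, hρ0, hρ, hmgf⟩ := hμ.exists_charFun_eq_exp (carriedBy_Ioi_iff.1 hμI).1 hc hc1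
    exact ⟨ρ, carriedBy_Ioi_of_mgf_eq_exp hμI hρ0 hc hmgf, hρ, hmgf⟩

end ConvolutionRoots

section GeometricLimits

variable {μ : ProbabilityMeasure ℝ} {ν η : ℕ → ProbabilityMeasure ℝ}

lemma IsGeomSum.charFun_mul_one_add {n : ℕ} {ν μ : ProbabilityMeasure ℝ}
    (h : IsGeomSum (1 / ((n : ℝ) + 1)) ν μ) (t : ℝ) :
    charFun (μ : Measure ℝ) t * (1 + n * (1 - charFun (ν : Measure ℝ) t))
      = charFun (ν : Measure ℝ) t := by
  have hmul := h.charFun_mul (by positivity) t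
  have : (n : ℂ) + 1 ≠ 0 := n.cast_add_one_ne_zero
  push_cast at hmul
  field_simp at hmul
  linear_combination hmul

lemma tendsto_diracProba_zero_iff_charFun :
    Tendsto ν atTop (𝓝 (diracProba 0)) ↔
      ∀ t, Tendsto (fun n => charFun (ν n : Measure ℝ) t) atTop (𝓝 1) := by
  rw [ProbabilityMeasure.tendsto_iff_tendsto_charFun]
  simp [diracProba]

theorem isGID_of_tendsto_geomSum (hν : Tendsto ν atTop (𝓝 (diracProba 0)))
    (hη : ∀ n : ℕ, IsGeomSum (1 / ((n : ℝ) + 1)) (ν n) (η n)) (hμ : Tendsto η atTop (𝓝 μ)) :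
    IsGID μ := by
  refine isGID_of_tendsto_inv
    (fun n => isGeomExponent_mul_one_sub_charFun n.cast_nonneg (ν n)) fun t => ?_
  have hν1 := tendsto_diracProba_zero_iff_charFun.1 hν t
  have hlim := (ProbabilityMeasure.tendsto_iff_tendsto_charFun.1 hμ t).div hν1 one_ne_zero
  rw [div_one] at hlim
  refine hlim.congr' ?_
  filter_upwards [hν1.eventually_ne one_ne_zero] with n hn
  have h := (hη n).charFun_mul_one_add t
  have hden := right_ne_zero_of_mul (h.trans_ne hn)
  rw [Pi.div_apply, Complex.ofReal_natCast, div_eq_iff hn, eq_inv_mul_iff_mul_eq₀ hden, mul_comm, h]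

lemma tendsto_nat_mul_one_sub_exp (θ : ℂ) :
    Tendsto (fun n : ℕ => n * (1 - Complex.exp (-(1 / ((n : ℂ) + 1) * θ)))) atTop (𝓝 θ) := by
  have hderiv : HasDerivAt (fun x : ℂ => Complex.exp (-(x * θ))) (-θ) 0 := by
    simpa using ((hasDerivAt_id (0 : ℂ)).mul_const θ).neg.cexp
  have hseq : Tendsto (fun n : ℕ => 1 / ((n : ℂ) + 1)) atTop (𝓝[≠] 0) :=
    tendsto_nhdsWithin_iff.2 ⟨tendsto_one_div_add_atTop_nhds_zero_nat,
      .of_forall fun n => one_div_ne_zero n.cast_add_one_ne_zero⟩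
  have hslope := (hderiv.tendsto_slope_zero.comp hseq).neg
  have hratio := hslope.mul (tendsto_natCast_div_add_atTop (𝕜 := ℂ) 1)
  rw [neg_neg, mul_one] at hratio
  refine hratio.congr fun n => ?_
  have : (n : ℂ) + 1 ≠ 0 := n.cast_add_one_ne_zero
  simp only [Function.comp_apply, zero_add, zero_mul, neg_zero, Complex.exp_zero, smul_eq_mul,
    one_div, inv_inv]
  field_simp
  ring

theorem gidClass_eq_geomLimitClass {I : Set ℝ} (hI : I = Set.Ici 0 ∨ I = Set.Ioi 0) :
    gidClass I = geomLimitClass I := by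
  ext μ
  rw [mem_gidClass_iff, mem_geomLimitClass_iff]
  refine and_congr_right fun hμI => ⟨fun hμ => ?_, ?_⟩
  · have hp (n : ℕ) : (0 : ℝ) < 1 / (n + 1) := Nat.one_div_pos_of_nat
    have hp1 (n : ℕ) : 1 / ((n : ℝ) + 1) ≤ 1 := by
      simpa using Nat.one_div_le_one_div (α := ℝ) n.zero_le
    choose ν hνI hν hψ using fun n =>
      hμ.exists_charFun_eq_exp_of_carriedBy hI hμI (hp n) (hp1 n)
    push_cast at hν
    choose η hη using fun n => exists_isGeomSum (hp n) (hp1 n) (ν n)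
    have hν1 (t : ℝ) : Tendsto (fun n => charFun (ν n : Measure ℝ) t) atTop (𝓝 1) := by
      simp only [hν]
      simpa using (tendsto_one_div_add_atTop_nhds_zero_nat.mul_const
        ((charFun (μ : Measure ℝ) t)⁻¹ - 1)).neg.cexp
    refine ⟨fun s => (mgf id (μ : Measure ℝ) (-s))⁻¹ - 1, ν, η, hνI,
      fun n u hu => by simpa using hψ n u hu, tendsto_diracProba_zero_iff_charFun.2 hν1, hη,
      ProbabilityMeasure.tendsto_iff_tendsto_charFun.2 fun t => ?_⟩
    have hg := inv_ne_zero (hμ.charFun_ne_zero t)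
    have hden := (tendsto_nat_mul_one_sub_exp ((charFun (μ : Measure ℝ) t)⁻¹ - 1)).const_add 1
    simp only [← hν, add_sub_cancel] at hden
    have hlim := (hν1 t).div hden hg
    rw [one_div, inv_inv] at hlim
    refine hlim.congr' ?_
    filter_upwards [hden.eventually_ne hg] with n hn
    exact div_eq_of_eq_mul hn ((hη n).charFun_mul_one_add t).symm
  · rintro ⟨ψ, ν, η, -, -, hν, hη, hlim⟩
    exact isGID_of_tendsto_geomSum hν hη hlim

end GeometricLimits

end GeomInfDiv

theorem theorem4p3 (I : Set ℝ) (hI : I = Set.Ici 0 ∨ I = Set.Ioi 0) :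
    GeomInfDiv.gidClass I = GeomInfDiv.charFunLimitClass I ∧
    GeomInfDiv.gidClass I = GeomInfDiv.geomLimitClass I ∧
    GeomInfDiv.gidClass I = GeomInfDiv.coxRenewalClass I :=
  ⟨GeomInfDiv.gidClass_eq_charFunLimitClass I, GeomInfDiv.gidClass_eq_geomLimitClass hI,
    GeomInfDiv.gidClass_eq_coxRenewalClass (by
      rcases hI with rfl | rfl
      exacts [measurableSet_Ici, measurableSet_Ioi])⟩
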